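/- All matroids are finite. For a matroid $M$ on $E$ with rank function $\mathrm{rk}$ and a flat $F$, let $M^F$ be the restriction of $M$ to $F$ and $M_F$ the contraction of $M$ by $F$; let $\mathcal L(M)$ be the lattice of flats and let $\chi_M(t)=\sum_{F\in\mathcal L(M)}\mu(\varnothing,F)\,t^{\mathrm{rk}(M)-\mathrm{rk}(F)}$ be the characteristic polynomial if $M$ has no loops, and $\chi_M=0$ if $M$ has a loop. The Kazhdan--Lusztig polynomial $P_M\in\mathbb Z[t]$ and the inverse Kazhdan--Lusztig polynomial $Q_M\in\mathbb Z[t]$ are the unique assignments such that: if $\mathrm{rk}(M)=0$ then $P_M=Q_M=1$ when $E=\varnothing$ and $P_M=Q_M=0$ otherwise; if $\mathrm{rk}(M)>0$ then $\deg P_M,\deg Q_M<\mathrm{rk}(M)/2$; and for every $M$ $$t^{\mathrm{rk}(M)}P_M(t^{-1})=\sum_{F\in\mathcal L(M)}\chi_{M^F}(t)P_{M_F}(t),\qquad (-t)^{\mathrm{rk}(M)}Q_M(t^{-1})=\sum_{F\in\mathcal L(M)}(-1)^{\mathrm{rk}(F)}Q_{M^F}(t)\,t^{\mathrm{rk}(M)-\mathrm{rk}(F)}\chi_{M_F}(t^{-1}).$$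 The $Z$-polynomial is $Z_M(t)=\sum_{F\in\mathcal L(M)}t^{\mathrm{rk}(F)}P_{M_F}(t)$. A hyperplane $H$ (flat of rank $\mathrm{rk}(M)-1$) of a matroid $M$ of rank $k$ is stressed if every $k$-element subset of $H$ is a circuit; its relaxation $\widetilde M$ is the matroid on $E$ whose bases are the bases of $M$ and the $k$-element subsets of $H$. Let $U_{k,n}$ be the uniform matroid of rank $k$ on $n$ elements. Let $k,h\ge 1$ be integers with $k\le h+1$. There are unique polynomials $p_{k,h},q_{k,h},z_{k,h}\in\mathbb Z[t]$ such that for every matroid $M$ of rank $k$ and every stressed hyperplane of $M$ of cardinality $h$, with relaxation $\widetilde M$, $$P_{\widetilde M}=P_M+p_{k,h},\qquad Q_{\widetilde M}=Q_M+q_{k,h},\qquad Z_{\widetilde M}=Z_M+z_{k,h},$$ and they are given by $$p_{k,h}=P_{U_{k,h+1}}-P_{U_{k-1,h}},\qquad q_{k,h}=Q_{U_{k,h+1}}-Q_{U_{k-1,h}},\qquad z_{k,h}=Z_{U_{k,h+1}}-(1+t)\,Z_{U_{k-1,h}}.$$ -/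

import Mathlib

open scoped Polynomial

universe u

namespace Matroid

/-! ### Ranks and flats of a finite matroid -/

/-- The rank of a set in a matroid, as a natural number. -/
noncomputable def rkNat {α : Type u} (M : Matroid α) (A : Set α) : ℕ := (M.eRk A).toNat

/-- The rank of a matroid, as a natural number. -/
noncomputable def rankNat {α : Type u} (M : Matroid α) : ℕ := M.rkNat M.E

theorem coe_rkNat {α : Type u} (M : Matroid α) [M.Finite] (A : Set α) :
    (M.rkNat A : ℕ∞) = M.eRk A :=
  ENat.natCast_toNat (eRk_ne_top_iff.2 (M.isRkFinite_set A))

/-- The poset of flats of a matroid, ordered by inclusion. -/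
abbrev FlatPoset {α : Type u} (M : Matroid α) : Type u := {F : Set α // M.IsFlat F}

instance flatPoset_finite {α : Type u} (M : Matroid α) [M.Finite] : Finite M.FlatPoset :=
  (M.ground_finite.finite_subsets.subset fun _ hF => IsFlat.subset_ground hF).to_subtype

noncomputable instance flatPoset_locallyFiniteOrder {α : Type u} (M : Matroid α) [M.Finite] :
    LocallyFiniteOrder M.FlatPoset :=
  LocallyFiniteOrder.ofFiniteIcc fun _ _ => Set.toFinite _

/-- The least flat (the set of loops). -/
def minFlat {α : Type u} (M : Matroid α) : M.FlatPoset :=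
  ⟨M.closure ∅, M.isFlat_closure ∅⟩

/-! ### The characteristic polynomial -/

open Classical in
/-- The characteristic polynomial `χ_M(t) = ∑_F μ(∅, F) t ^ (rk M - rk F)`, the sum being over the
flats of `M` and `μ` being the Möbius function of the lattice of flats. As usual, `χ_M = 0` if `M`
has a loop. -/
noncomputable def charPolynomial {α : Type u} (M : Matroid α) [M.Finite] : ℤ[X] :=
  if M.loops = ∅ then
    ∑ᶠ F : M.FlatPoset, Polynomial.C (IncidenceAlgebra.mu ℤ M.minFlat F) *
      Polynomial.X ^ (M.rankNat - M.rkNat F)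
  else 0

/-! ### Kazhdan–Lusztig polynomials -/

/-- The part of `f` consisting of the monomials `t ^ i` with `i < r / 2`. -/
noncomputable def lowerHalf (r : ℕ) (f : ℤ[X]) : ℤ[X] :=
  ∑ i ∈ (Finset.range r).filter (fun i => 2 * i < r), Polynomial.monomial i (f.coeff i)

open Classical in
/-- The Kazhdan–Lusztig polynomial `P_M`. It is `1` for the empty matroid, `0` for the other
matroids of rank `0`, and for `rk M > 0` it is the polynomial of degree `< rk M / 2` determined by
`t ^ rk M * P_M(1/t) = ∑_F χ_{M^F}(t) * P_{M_F}(t)` (sum over all flats `F`, with `M^F = M ↾ F` and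
`M_F = M ／ F`): the left side has only monomials of degree `> rk M / 2`, so the
monomials of degree `< rk M / 2` of the term `F = ∅`, which is `P_M(t)`, cancel those of the sum of
the other terms. That this is the only candidate is `eq_klPolynomial` below. -/
noncomputable def klPolynomial {α : Type u} (M : Matroid α) [hM : M.Finite] : ℤ[X] :=
  if M.rankNat = 0 then (if M.E = ∅ then 1 else 0)
  else -lowerHalf M.rankNat (∑ᶠ F : {F : M.FlatPoset // F.1.Nonempty},
    haveI : (M ↾ F.1.1).Finite := ⟨M.ground_finite.subset F.1.2.subset_ground⟩
    (M ↾ F.1.1).charPolynomial * (M ／ F.1.1).klPolynomial)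
termination_by M.E.ncard
decreasing_by
  obtain ⟨x, hx⟩ := F.2
  have hxE : x ∈ M.E := F.1.2.subset_ground hx
  exact Set.ncard_lt_ncard ⟨Set.sdiff_subset, fun h => (h hxE).2 hx⟩ M.ground_finite

open Classical in
/-- The inverse Kazhdan–Lusztig polynomial `Q_M`. It is `1` for the empty matroid, `0` for the other
matroids of rank `0`, and for `rk M > 0` it is the polynomial of degree `< rk M / 2` determined by
`(-t) ^ rk M * Q_M(1/t) =
∑_F (-1) ^ rk F * Q_{M^F}(t) * t ^ (rk M - rk F) * χ_{M_F}(1/t)` (sum over all flats `F`): again the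
left side has no monomial of degree `< rk M / 2`, and the term `F = E` is `(-1) ^ rk M * Q_M(t)`.
That this is the only candidate is `eq_invKLPolynomial` below. -/
noncomputable def invKLPolynomial {α : Type u} (M : Matroid α) [hM : M.Finite] : ℤ[X] :=
  if M.rankNat = 0 then (if M.E = ∅ then 1 else 0)
  else -(-1) ^ M.rankNat * lowerHalf M.rankNat (∑ᶠ F : {F : M.FlatPoset // F.1 ≠ M.E},
    haveI : (M ↾ F.1.1).Finite := ⟨M.ground_finite.subset F.1.2.subset_ground⟩
    (-1) ^ M.rkNat F.1.1 * (M ↾ F.1.1).invKLPolynomial *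
      (M ／ F.1.1).charPolynomial.reflect (M.rankNat - M.rkNat F.1.1))
termination_by M.E.ncard
decreasing_by
  exact Set.ncard_lt_ncard (F.1.2.subset_ground.ssubset_of_ne F.2) M.ground_finite

/-- The `Z`-polynomial `Z_M(t) = ∑_F t ^ rk F * P_{M_F}(t)`, the sum being over all flats. -/
noncomputable def zPolynomial {α : Type u} (M : Matroid α) [M.Finite] : ℤ[X] :=
  ∑ᶠ F : M.FlatPoset, Polynomial.X ^ M.rkNat F.1 * (M ／ F.1).klPolynomial

/-! ### The characterizations of `P_M` and `Q_M` -/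

theorem restrict_flat_finite {α : Type u} (M : Matroid α) [M.Finite] (F : M.FlatPoset) :
    (M ↾ F.1).Finite :=
  ⟨M.ground_finite.subset F.2.subset_ground⟩

theorem charPolynomial_of_ground_eq_empty {α : Type u} (M : Matroid α) [M.Finite] (h : M.E = ∅) :
    M.charPolynomial = 1 := by
  have hl : M.loops = ∅ := Set.subset_empty_iff.1 (h ▸ M.closure_subset_ground ∅)
  have hs : ∀ F : M.FlatPoset, F = M.minFlat := fun F => Subtype.ext (by
    have h1 : F.1 = ∅ := Set.subset_empty_iff.1 (h ▸ F.2.subset_ground)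
    have h2 : M.minFlat.1 = ∅ := Set.subset_empty_iff.1 (h ▸ M.minFlat.2.subset_ground)
    rw [h1, h2])
  have : Unique M.FlatPoset := ⟨⟨M.minFlat⟩, hs⟩
  have h0 : M.rankNat = 0 := by simp [rankNat, rkNat, h]
  rw [charPolynomial, if_pos hl, finsum_unique, hs default, h0]
  simp

theorem coeff_lowerHalf (r : ℕ) (f : ℤ[X]) (i : ℕ) :
    (lowerHalf r f).coeff i = if 2 * i < r then f.coeff i else 0 := by
  simp only [lowerHalf, Polynomial.finsetSum_coeff, Polynomial.coeff_monomial]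
  rw [Finset.sum_ite_eq']
  by_cases h : 2 * i < r
  · rw [if_pos (by simp; omega), if_pos h]
  · rw [if_neg (by simp; omega), if_neg h]

theorem coeff_reflect_of_lt {r i : ℕ} {f : ℤ[X]} (hf : 2 * f.natDegree < r) (hi : 2 * i < r) :
    (f.reflect r).coeff i = 0 := by
  rw [Polynomial.coeff_reflect, Polynomial.revAt_le (by omega)]
  exact Polynomial.coeff_eq_zero_of_natDegree_lt (by omega)

/-- A family of polynomials with the three defining properties of the Kazhdan–Lusztig polynomials
of matroids is the family `klPolynomial`. -/
theorem eq_klPolynomial {α : Type u} (P : ∀ (M : Matroid α) [M.Finite], ℤ[X])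
    (h_zero : ∀ (M : Matroid α) [M.Finite], M.rankNat = 0 →
      (M.E = ∅ → P M = 1) ∧ (M.E ≠ ∅ → P M = 0))
    (h_deg : ∀ (M : Matroid α) [M.Finite], 0 < M.rankNat → 2 * (P M).natDegree < M.rankNat)
    (h_rec : ∀ (M : Matroid α) [M.Finite], (P M).reflect M.rankNat = ∑ᶠ F : M.FlatPoset,
      haveI := M.restrict_flat_finite F
      (M ↾ F.1).charPolynomial * P (M ／ F.1))
    (M : Matroid α) [M.Finite] : P M = M.klPolynomial := by
  induction hn : M.E.ncard using Nat.strong_induction_on generalizing M with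
  | _ n ih =>
  rw [klPolynomial]
  by_cases h0 : M.rankNat = 0
  · rw [if_pos h0]
    split_ifs with hE
    · exact (h_zero M h0).1 hE
    · exact (h_zero M h0).2 hE
  rw [if_neg h0]
  have hIH : ∀ F : {F : M.FlatPoset // F.1.Nonempty},
      P (M ／ F.1.1) = (M ／ F.1.1).klPolynomial := by
    intro F
    refine ih _ ?_ (M ／ F.1.1) rfl
    obtain ⟨x, hx⟩ := F.2
    have hxE : x ∈ M.E := F.1.2.subset_ground hx
    rw [← hn]
    exact Set.ncard_lt_ncard ⟨Set.sdiff_subset, fun h => (h hxE).2 hx⟩ M.ground_finite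
  simp only [← hIH]
  have hrec := h_rec M
  have hdeg := h_deg M (Nat.pos_of_ne_zero h0)
  set S := ∑ᶠ F : {F : M.FlatPoset // F.1.Nonempty},
    haveI := M.restrict_flat_finite F.1
    (M ↾ F.1.1).charPolynomial * P (M ／ F.1.1) with hS
  have hsplit : (P M).reflect M.rankNat = P M + S := by
    classical
    have := Fintype.ofFinite M.FlatPoset
    by_cases hl : M.loops = ∅
    · have hmin : M.IsFlat ∅ := by
        have := M.isFlat_closure ∅
        rwa [show M.closure ∅ = ∅ from hl] at this
      rw [hrec, hS, finsum_eq_sum_of_fintype, finsum_eq_sum_of_fintype,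
        ← Fintype.sum_subtype_add_sum_subtype (fun F : M.FlatPoset => F.1.Nonempty), add_comm]
      congr 1
      have : Unique {F : M.FlatPoset // ¬ F.1.Nonempty} :=
        ⟨⟨⟨⟨∅, hmin⟩, by simp⟩⟩, fun F => Subtype.ext (Subtype.ext
          (Set.not_nonempty_iff_eq_empty.1 F.2))⟩
      rw [Fintype.sum_unique]
      have hP : ∀ (N : Matroid α) [N.Finite], N = M → P N = P M := by
        rintro N _ rfl
        rfl
      have hd : ((default : {F : M.FlatPoset // ¬ F.1.Nonempty}).1.1) = ∅ :=
        Set.not_nonempty_iff_eq_empty.1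
          (default : {F : M.FlatPoset // ¬ F.1.Nonempty}).2
      have := M.restrict_flat_finite (default : {F : M.FlatPoset // ¬ F.1.Nonempty}).1
      rw [charPolynomial_of_ground_eq_empty _ hd, one_mul]
      exact hP _ (by rw [hd, contract_empty])
    · have hz : ∀ F : M.FlatPoset,
          haveI := M.restrict_flat_finite F
          (M ↾ F.1).charPolynomial = 0 := by
        intro F
        rw [charPolynomial, if_neg]
        rw [restrict_loops_eq F.2.subset_ground]
        have : M.loops ⊆ F.1 := F.2.loops_subset
        rwa [Set.inter_eq_left.2 this]
      have hS0 : S = 0 := by simp [hS, hz]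
      have hP0 : P M = 0 := by
        rw [← Polynomial.reflect_eq_zero_iff (N := M.rankNat), hrec]
        simp [hz]
      simp [hS0, hP0]
  ext i
  have hc := congrArg (fun f => Polynomial.coeff f i) hsplit
  simp only [Polynomial.coeff_add] at hc
  rw [Polynomial.coeff_neg, coeff_lowerHalf]
  split_ifs with hi
  · rw [coeff_reflect_of_lt hdeg hi] at hc
    linarith
  · rw [neg_zero]
    exact Polynomial.coeff_eq_zero_of_natDegree_lt (by omega)

/-- A family of polynomials with the three defining properties of the inverse Kazhdan–Lusztig
polynomials of matroids is the family `invKLPolynomial`. -/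
theorem eq_invKLPolynomial {α : Type u} (Q : ∀ (M : Matroid α) [M.Finite], ℤ[X])
    (h_zero : ∀ (M : Matroid α) [M.Finite], M.rankNat = 0 →
      (M.E = ∅ → Q M = 1) ∧ (M.E ≠ ∅ → Q M = 0))
    (h_deg : ∀ (M : Matroid α) [M.Finite], 0 < M.rankNat → 2 * (Q M).natDegree < M.rankNat)
    (h_rec : ∀ (M : Matroid α) [M.Finite],
      (-1) ^ M.rankNat * (Q M).reflect M.rankNat = ∑ᶠ F : M.FlatPoset,
        haveI := M.restrict_flat_finite F
        (-1) ^ M.rkNat F.1 * Q (M ↾ F.1) *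
          (M ／ F.1).charPolynomial.reflect (M.rankNat - M.rkNat F.1))
    (M : Matroid α) [M.Finite] : Q M = M.invKLPolynomial := by
  induction hn : M.E.ncard using Nat.strong_induction_on generalizing M with
  | _ n ih =>
  rw [invKLPolynomial]
  by_cases h0 : M.rankNat = 0
  · rw [if_pos h0]
    split_ifs with hE
    · exact (h_zero M h0).1 hE
    · exact (h_zero M h0).2 hE
  rw [if_neg h0]
  have hIH : ∀ F : {F : M.FlatPoset // F.1 ≠ M.E},
      haveI := M.restrict_flat_finite F.1
      Q (M ↾ F.1.1) = (M ↾ F.1.1).invKLPolynomial := by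
    intro F
    have := M.restrict_flat_finite F.1
    refine ih _ ?_ (M ↾ F.1.1) rfl
    rw [← hn]
    exact Set.ncard_lt_ncard (F.1.2.subset_ground.ssubset_of_ne F.2) M.ground_finite
  simp only [← hIH]
  have hrec := h_rec M
  have hdeg := h_deg M (Nat.pos_of_ne_zero h0)
  set S := ∑ᶠ F : {F : M.FlatPoset // F.1 ≠ M.E},
    haveI := M.restrict_flat_finite F.1
    (-1) ^ M.rkNat F.1.1 * Q (M ↾ F.1.1) *
      (M ／ F.1.1).charPolynomial.reflect (M.rankNat - M.rkNat F.1.1) with hS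
  have hsplit : (-1) ^ M.rankNat * (Q M).reflect M.rankNat = S + (-1) ^ M.rankNat * Q M := by
    classical
    have := Fintype.ofFinite M.FlatPoset
    rw [hrec, hS, finsum_eq_sum_of_fintype, finsum_eq_sum_of_fintype,
      ← Fintype.sum_subtype_add_sum_subtype (fun F : M.FlatPoset => F.1 ≠ M.E)]
    congr 1
    have : Unique {F : M.FlatPoset // ¬ F.1 ≠ M.E} :=
      ⟨⟨⟨⟨M.E, M.ground_isFlat⟩, by simp⟩⟩, fun F => Subtype.ext (Subtype.ext
        (not_not.1 F.2))⟩
    rw [Fintype.sum_unique]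
    have hQ : ∀ (N : Matroid α) [N.Finite], N = M → Q N = Q M := by
      rintro N _ rfl
      rfl
    have hd : ((default : {F : M.FlatPoset // ¬ F.1 ≠ M.E}).1.1) = M.E :=
      not_not.1 (default : {F : M.FlatPoset // ¬ F.1 ≠ M.E}).2
    have := M.restrict_flat_finite (default : {F : M.FlatPoset // ¬ F.1 ≠ M.E}).1
    have hE : (M ／ (default : {F : M.FlatPoset // ¬ F.1 ≠ M.E}).1.1).E = ∅ := by
      rw [contract_ground, hd, Set.sdiff_self]
    rw [charPolynomial_of_ground_eq_empty _ hE, hQ (M ↾ _) (by rw [hd, restrict_ground_eq_self]),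
      hd]
    have : M.rankNat - M.rkNat M.E = 0 := Nat.sub_self _
    rw [this]
    simp [rankNat]
  have hsq : ((-1 : ℤ[X]) ^ M.rankNat) * (-1) ^ M.rankNat = 1 := by
    rw [← mul_pow]
    simp
  have hsplit' : (Q M).reflect M.rankNat = (-1) ^ M.rankNat * S + Q M := by
    linear_combination (-1) ^ M.rankNat * hsplit + (Q M - (Q M).reflect M.rankNat) * hsq
  have hsgn : (-1 : ℤ[X]) ^ M.rankNat = Polynomial.C ((-1) ^ M.rankNat) := by simp
  rw [hsgn] at hsplit' ⊢
  ext i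
  have hc := congrArg (fun f => Polynomial.coeff f i) hsplit'
  simp only [Polynomial.coeff_add, Polynomial.coeff_C_mul] at hc
  rw [neg_mul, Polynomial.coeff_neg, Polynomial.coeff_C_mul, coeff_lowerHalf]
  split_ifs with hi
  · rw [coeff_reflect_of_lt hdeg hi] at hc
    linarith
  · rw [mul_zero, neg_zero]
    exact Polynomial.coeff_eq_zero_of_natDegree_lt (by omega)

/-! ### Uniform matroids -/

/-- The uniform matroid `U_{k,n}` on `{0, …, n - 1}` (for `k ≤ n`): a set is independent if and only
if it has at most `k` elements. -/
def uniform (k n : ℕ) : Matroid (Fin n) :=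
  (IndepMatroid.ofFinite (E := Set.univ) Set.finite_univ (fun I => I.ncard ≤ k)
    (by simp)
    (fun I J hJ hIJ => (Set.ncard_le_ncard hIJ (Set.toFinite J)).trans hJ)
    (fun I J _ hJ hlt => by
      obtain ⟨e, heJ, heI⟩ := Set.exists_mem_notMem_of_ncard_lt_ncard hlt (Set.toFinite I)
      refine ⟨e, heJ, heI, ?_⟩
      rw [Set.ncard_insert_of_notMem heI (Set.toFinite I)]
      omega)
    (fun I _ => Set.subset_univ I)).matroid

instance uniform_finite (k n : ℕ) : (uniform k n).Finite := ⟨Set.toFinite _⟩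

/-- For `k ≤ n`, the bases of `U_{k,n}` are the sets with `k` elements. -/
theorem uniform_isBase_iff {k n : ℕ} (hkn : k ≤ n) (B : Set (Fin n)) :
    (uniform k n).IsBase B ↔ B.ncard = k := by
  have hI : ∀ I : Set (Fin n), (uniform k n).Indep I ↔ I.ncard ≤ k := fun I => by
    simp [uniform]
  rw [isBase_iff_maximal_indep, maximal_subset_iff]
  simp only [hI]
  constructor
  · rintro ⟨hB, hmax⟩
    by_contra hne
    have hlt : B.ncard < (Set.univ : Set (Fin n)).ncard := by
      rw [Set.ncard_univ, Nat.card_eq_fintype_card, Fintype.card_fin]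
      omega
    obtain ⟨e, -, he⟩ := Set.exists_mem_notMem_of_ncard_lt_ncard hlt (Set.toFinite B)
    have h := hmax (t := insert e B)
      (by rw [Set.ncard_insert_of_notMem he (Set.toFinite B)]; omega) (Set.subset_insert e B)
    exact he (h ▸ Set.mem_insert e B)
  · intro hB
    refine ⟨hB.le, fun t ht hBt => Set.eq_of_subset_of_ncard_le hBt ?_ (Set.toFinite t)⟩
    omega

/-! ### Stressed hyperplanes and their relaxation -/

/-- A hyperplane is a flat of rank `rk M - 1`. It is stressed if all its subsets of cardinality
`rk M` are circuits. -/
structure IsStressedHyperplane {α : Type u} (M : Matroid α) (H : Set α) : Prop where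
  isFlat : M.IsFlat H
  rkNat_add_one : M.rkNat H + 1 = M.rankNat
  isCircuit : ∀ S ⊆ H, S.ncard = M.rankNat → M.IsCircuit S

theorem IsStressedHyperplane.exchange {α : Type u} {M : Matroid α} [M.Finite] {H : Set α}
    (hH : M.IsStressedHyperplane H) :
    Matroid.ExchangeProperty (fun B => M.IsBase B ∨ (B ⊆ H ∧ B.ncard = M.rankNat)) := by
  have hfin : ∀ B : Set α, (M.IsBase B ∨ (B ⊆ H ∧ B.ncard = M.rankNat)) → B.Finite := fun B hB =>
    M.ground_finite.subset (hB.elim (fun h => h.subset_ground)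
      (fun h => h.1.trans hH.isFlat.subset_ground))
  have hcard : ∀ B : Set α, (M.IsBase B ∨ (B ⊆ H ∧ B.ncard = M.rankNat)) →
      B.ncard = M.rankNat := by
    rintro B (hB | hB)
    · rw [Set.ncard, hB.encard_eq_eRank, rankNat, rkNat, eRk_ground]
    · exact hB.2
  have hHk : M.eRk H + 1 = M.eRank := by
    rw [← eRk_ground, ← M.coe_rkNat, ← M.coe_rkNat M.E]
    exact_mod_cast hH.rkNat_add_one
  have hrank : (M.rankNat : ℕ∞) = M.eRank := by rw [rankNat, coe_rkNat, eRk_ground]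
  intro B₁ B₂ h₁ h₂ e he
  have hI : M.Indep (B₁ \ {e}) := by
    rcases h₁ with h | h
    · exact h.indep.subset Set.sdiff_subset
    · exact (hH.isCircuit B₁ h.1 h.2).sdiff_singleton_indep he.1
  have hIcard : (B₁ \ {e}).encard + 1 = M.eRank := by
    rw [Set.encard_sdiff_singleton_add_one he.1, ← (hfin B₁ h₁).cast_ncard_eq, hcard B₁ h₁, hrank]
  have hfinI : (B₁ \ {e}).Finite := (hfin B₁ h₁).subset Set.sdiff_subset
  have hnotBase : ¬ M.IsBase (B₁ \ {e}) := fun h => by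
    rw [← h.encard_eq_eRank, ← hfinI.cast_ncard_eq] at hIcard
    norm_cast at hIcard
    omega
  have hmem : ∀ y ∈ B₂, y ∉ B₁ \ {e} → y ∈ B₂ \ B₁ := fun y hy hyI =>
    ⟨hy, fun hy1 => hyI ⟨hy1, fun hye => he.2 (hye ▸ hy)⟩⟩
  rcases h₂ with h₂ | h₂
  · obtain ⟨y, hy, hbase⟩ := hI.exists_insert_of_not_isBase hnotBase h₂
    refine ⟨y, hmem y hy.1 hy.2, Or.inl (hbase.isBase_of_eRk_ge (hfinI.insert y) ?_)⟩
    rw [hbase.eRk_eq_encard, Set.encard_insert_of_notMem hy.2, hIcard]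
  · by_cases hIH : B₁ \ {e} ⊆ H
    · have hlt : (B₁ \ {e}).ncard < B₂.ncard := by
        have := Set.ncard_sdiff_singleton_add_one he.1 (hfin B₁ h₁)
        rw [h₂.2, ← hcard B₁ h₁]
        omega
      obtain ⟨y, hy, hyI⟩ := Set.exists_mem_notMem_of_ncard_lt_ncard hlt hfinI
      refine ⟨y, hmem y hy hyI, Or.inr ⟨Set.insert_subset (h₂.1 hy) hIH, ?_⟩⟩
      rw [Set.ncard_insert_of_notMem hyI hfinI, Set.ncard_sdiff_singleton_add_one he.1 (hfin B₁ h₁),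
        hcard B₁ h₁]
    · obtain ⟨x, hxI, hxH⟩ := Set.not_subset.1 hIH
      have hcirc := hH.isCircuit B₂ h₂.1 h₂.2
      have hB₂E := hcirc.subset_ground
      have hrk : M.eRk H ≤ M.eRk B₂ := by
        have h1 : M.eRk B₂ + 1 = M.eRank := by
          rw [hcirc.eRk_add_one_eq, ← (hfin B₂ (Or.inr h₂)).cast_ncard_eq, h₂.2, hrank]
        exact (WithTop.add_right_inj (by simp : (1 : ℕ∞) ≠ ⊤)).1 (hHk.trans h1.symm) |>.le
      have hcl : M.closure B₂ = H := by
        rw [(M.isRkFinite_set B₂).closure_eq_closure_of_subset_of_eRk_ge_eRk h₂.1 hrk,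
          hH.isFlat.closure]
      obtain ⟨y, hy, hycl⟩ : ∃ y ∈ B₂, y ∉ M.closure (B₁ \ {e}) := by
        by_contra! hcon
        have hsub : insert x H ⊆ M.closure (B₁ \ {e}) := by
          refine Set.insert_subset (M.mem_closure_of_mem hxI hI.subset_ground) ?_
          rw [← hcl]
          exact closure_subset_closure_of_subset_closure hcon
        have h2 := M.eRk_mono hsub
        rw [eRk_insert_eq_add_one ⟨hI.subset_ground hxI, by rwa [hH.isFlat.closure]⟩,
          eRk_closure_eq, hHk, hI.eRk_eq_encard, ← hIcard, ← hfinI.cast_ncard_eq] at h2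
        norm_cast at h2
        omega
      have hyI : y ∉ B₁ \ {e} := fun h => hycl (M.mem_closure_of_mem h hI.subset_ground)
      have hins : M.Indep (insert y (B₁ \ {e})) :=
        hI.insert_indep_iff.2 (Or.inl ⟨hB₂E hy, hycl⟩)
      refine ⟨y, hmem y hy hyI, Or.inl (hins.isBase_of_eRk_ge (hfinI.insert y) ?_)⟩
      rw [hins.eRk_eq_encard, Set.encard_insert_of_notMem hyI, hIcard]

/-- The relaxation of a stressed hyperplane `H` of a matroid `M` of rank `k`: the matroid on the
ground set of `M` whose bases are the bases of `M` and the `k`-element subsets of `H`. -/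
def relaxation {α : Type u} (M : Matroid α) [M.Finite] {H : Set α}
    (hH : M.IsStressedHyperplane H) : Matroid α :=
  Matroid.ofIsBaseOfFinite M.ground_finite
    (fun B => M.IsBase B ∨ (B ⊆ H ∧ B.ncard = M.rankNat))
    (M.exists_isBase.imp fun _ hB => Or.inl hB)
    hH.exchange
    (fun _ hB => hB.elim (fun h => h.subset_ground)
      (fun h => h.1.trans hH.isFlat.subset_ground))

instance relaxation_finite {α : Type u} (M : Matroid α) [M.Finite] {H : Set α}
    (hH : M.IsStressedHyperplane H) : (M.relaxation hH).Finite := ⟨M.ground_finite⟩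

/-- `f` is the change of the matroid invariant `Φ` under relaxation of stressed hyperplanes of
cardinality `h` in matroids of rank `k`: for every matroid `M` of rank `k` with a stressed
hyperplane `H` of cardinality `h`, the relaxation of `H` changes `Φ M` to `Φ M + f`. -/
def IsRelaxationCorrection (Φ : ∀ (α : Type u) (M : Matroid α) [M.Finite], ℤ[X]) (k h : ℕ)
    (f : ℤ[X]) : Prop :=
  ∀ (α : Type u) (M : Matroid α) [M.Finite] (H : Set α) (hH : M.IsStressedHyperplane H),
    M.rankNat = k → H.ncard = h → Φ α (M.relaxation hH) = Φ α M + f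

end Matroid

-- For a loopless matroid, P and Q depend only on the lattice of flats with its rank function. A
-- loop makes both vanish. The Z-polynomial only sees contractions by flats, which never have loops.
-- The problem is therefore one about two ranked lattices.
--
-- Let H be a stressed hyperplane of a matroid of rank k on E. Relaxation keeps the flats not inside
-- H, with their ranks. Inside H, the flats before relaxation are the subsets with fewer than k - 1
-- elements ("small" sets) and H itself; afterwards they are the subsets with at most k - 1 elements
-- (`IsRelaxationPair`). The proper flats common to both matroids form a lower set in each lattice,
-- so μ, χ and Q agree on intervals between them. The flats not inside H form an upper set in each
-- lattice, so P agrees on [F, E] for such F.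
--
-- Subtract the two recursions (`sum_sub_sum`): proper flats not inside H cancel. What remains comes
-- from E, the small sets, the (k - 1)-subsets of H, and H. The last two kinds are covered by E,
-- where P = 1, and everything else lives on subsets of an h-element set. So the changes of μ(A, E),
-- χ and P on [A, E], for A small, depend on k and h alone (`moebius_top_sub`, `charPoly_top_sub`,
-- `kl_sub_eq`), and so do those of Q and Z.
--
-- One example then determines the corrections: the direct sum of U_{k-1,h} and a coloop. Its
-- uniform summand is a stressed hyperplane whose relaxation is U_{k,h+1}
-- (`relaxation_addColoop_uniform`). A coloop multiplies the lattice of flats by a two-element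
-- chain, which preserves P and Q and multiplies Z by 1 + t. In rank one, P and Q are treated
-- separately: H is then the set of loops, and both change from 0 to 1.

universe v w

namespace RankedPoset

open Finset Matroid

/-! ### Möbius functions, characteristic and Kazhdan–Lusztig polynomials of intervals -/

section General

variable {S : Type*} [PartialOrder S] [LocallyFiniteOrder S]

open Classical in
/-- The Möbius function of a locally finite poset, with integer values. -/
noncomputable def moebius (x y : S) : ℤ := IncidenceAlgebra.mu ℤ x y

/-- The characteristic polynomial of the interval `[x, y]` for the rank function `ρ`. -/
noncomputable def charPoly (ρ : S → ℕ) (x y : S) : ℤ[X] :=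
  ∑ z ∈ Icc x y, Polynomial.C (moebius x z) * Polynomial.X ^ (ρ y - ρ z)

open Classical in
/-- The Kazhdan–Lusztig polynomial of the interval `[x, y]` for the rank function `ρ`. -/
noncomputable def kl (ρ : S → ℕ) (x y : S) : ℤ[X] :=
  if x = y then 1
  else -lowerHalf (ρ y - ρ x) (∑ z : {z // z ∈ Ioc x y}, charPoly ρ x z * kl ρ z y)
termination_by (Icc x y).card
decreasing_by
  have hz := mem_Ioc.1 z.2
  exact card_lt_card (Icc_ssubset_Icc_left (hz.1.le.trans hz.2) hz.1 le_rfl)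

open Classical in
/-- The inverse Kazhdan–Lusztig polynomial of the interval `[x, y]` for the rank function `ρ`. -/
noncomputable def invKL (ρ : S → ℕ) (x y : S) : ℤ[X] :=
  if x = y then 1
  else -(-1) ^ (ρ y - ρ x) * lowerHalf (ρ y - ρ x) (∑ z : {z // z ∈ Ico x y},
    (-1) ^ (ρ z - ρ x) * invKL ρ x z * (charPoly ρ z y).reflect (ρ y - ρ z))
termination_by (Icc x y).card
decreasing_by
  have hz := mem_Ico.1 z.2
  exact card_lt_card (Icc_ssubset_Icc_right (hz.1.trans hz.2.le) le_rfl hz.2)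

@[simp] theorem moebius_self (x : S) : moebius x x = 1 := by simp [moebius]

theorem moebius_of_ne {x y : S} (h : x ≠ y) : moebius x y = -∑ z ∈ Ico x y, moebius x z := by
  classical
  simp only [moebius]
  exact IncidenceAlgebra.mu_eq_neg_sum_Ico_of_ne h

@[simp] theorem kl_self (ρ : S → ℕ) (x : S) : kl ρ x x = 1 := by rw [kl, if_pos rfl]

@[simp] theorem invKL_self (ρ : S → ℕ) (x : S) : invKL ρ x x = 1 := by rw [invKL, if_pos rfl]

theorem kl_of_ne (ρ : S → ℕ) {x y : S} (h : x ≠ y) :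
    kl ρ x y = -lowerHalf (ρ y - ρ x) (∑ z ∈ Ioc x y, charPoly ρ x z * kl ρ z y) := by
  rw [kl, if_neg h, sum_coe_sort (Ioc x y) (fun z => charPoly ρ x z * kl ρ z y)]

theorem invKL_of_ne (ρ : S → ℕ) {x y : S} (h : x ≠ y) :
    invKL ρ x y = -(-1) ^ (ρ y - ρ x) * lowerHalf (ρ y - ρ x) (∑ z ∈ Ico x y,
      (-1) ^ (ρ z - ρ x) * invKL ρ x z * (charPoly ρ z y).reflect (ρ y - ρ z)) := by
  rw [invKL, if_neg h, sum_coe_sort (Ico x y) (fun z =>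
    (-1) ^ (ρ z - ρ x) * invKL ρ x z * (charPoly ρ z y).reflect (ρ y - ρ z))]

@[simp] theorem charPoly_self (ρ : S → ℕ) (x : S) : charPoly ρ x x = 1 := by
  simp [charPoly]

end General

/-! ### Transport along embeddings with order-connected range -/

section Embedding

variable {S T : Type*} [PartialOrder S] [LocallyFiniteOrder S] [PartialOrder T]
  [LocallyFiniteOrder T] (f : S ↪o T) (hf : (Set.range f).OrdConnected)

include hf

/-- Order-connectedness of the range says that nothing new appears between two image points.
Invariants defined by recursion over intervals can then be transported by induction. -/
theorem Icc_map (x y : S) : Icc (f x) (f y) = (Icc x y).map f.toEmbedding := by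
  ext t
  simp only [mem_Icc, mem_map, RelEmbedding.coe_toEmbedding]
  constructor
  · intro h
    obtain ⟨z, rfl⟩ := hf.out ⟨x, rfl⟩ ⟨y, rfl⟩ h
    exact ⟨z, by simpa using h, rfl⟩
  · rintro ⟨z, hz, rfl⟩
    simpa using hz

theorem Ico_map (x y : S) : Ico (f x) (f y) = (Ico x y).map f.toEmbedding := by
  ext t
  simp only [mem_Ico, mem_map, RelEmbedding.coe_toEmbedding]
  constructor
  · intro h
    obtain ⟨z, rfl⟩ := hf.out ⟨x, rfl⟩ ⟨y, rfl⟩ ⟨h.1, h.2.le⟩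
    exact ⟨z, by simpa using h, rfl⟩
  · rintro ⟨z, hz, rfl⟩
    simpa using hz

theorem Ioc_map (x y : S) : Ioc (f x) (f y) = (Ioc x y).map f.toEmbedding := by
  ext t
  simp only [mem_Ioc, mem_map, RelEmbedding.coe_toEmbedding]
  constructor
  · intro h
    obtain ⟨z, rfl⟩ := hf.out ⟨x, rfl⟩ ⟨y, rfl⟩ ⟨h.1.le, h.2⟩
    exact ⟨z, by simpa using h, rfl⟩
  · rintro ⟨z, hz, rfl⟩
    simpa using hz

theorem moebius_map (x y : S) : moebius (f x) (f y) = moebius x y := by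
  induction hn : (Icc x y).card using Nat.strong_induction_on generalizing y with
  | _ n ih =>
  by_cases h : x = y
  · simp [h]
  rw [moebius_of_ne h, moebius_of_ne (by simpa using h), Ico_map f hf, sum_map]
  refine congrArg _ (sum_congr rfl fun z hz => ih _ ?_ z rfl)
  have hz := mem_Ico.1 hz
  rw [← hn]
  exact card_lt_card (Icc_ssubset_Icc_right (hz.1.trans hz.2.le) le_rfl hz.2)

variable {ρ : S → ℕ} {ρ' : T → ℕ} (hρ : ∀ x y, x ≤ y → ρ' (f y) - ρ' (f x) = ρ y - ρ x)

include hρ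

/-- Only rank differences matter, which is what allows the flats of a contraction, whose ranks are
shifted by the rank of the contracted flat. -/
theorem charPoly_map (x y : S) : charPoly ρ' (f x) (f y) = charPoly ρ x y := by
  rw [charPoly, charPoly, Icc_map f hf, sum_map]
  refine sum_congr rfl fun z hz => ?_
  simp [moebius_map f hf, hρ z y (mem_Icc.1 hz).2]

theorem kl_map {x y : S} (hxy : x ≤ y) : kl ρ' (f x) (f y) = kl ρ x y := by
  induction hn : (Icc x y).card using Nat.strong_induction_on generalizing x with
  | _ n ih =>
  by_cases h : x = y
  · simp [h]
  rw [kl_of_ne _ h, kl_of_ne _ (by simpa using h), Ioc_map f hf, sum_map, hρ x y hxy]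
  refine congrArg _ (congrArg _ (sum_congr rfl fun z hz => ?_))
  have hz := mem_Ioc.1 hz
  simp only [RelEmbedding.coe_toEmbedding]
  rw [charPoly_map f hf hρ, ih _ ?_ hz.2 rfl]
  rw [← hn]
  exact card_lt_card (Icc_ssubset_Icc_left (hz.1.le.trans hz.2) hz.1 le_rfl)

theorem invKL_map {x y : S} (hxy : x ≤ y) : invKL ρ' (f x) (f y) = invKL ρ x y := by
  induction hn : (Icc x y).card using Nat.strong_induction_on generalizing y with
  | _ n ih =>
  by_cases h : x = y
  · simp [h]
  rw [invKL_of_ne _ h, invKL_of_ne _ (by simpa using h), Ico_map f hf, sum_map, hρ x y hxy]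
  refine congrArg _ (congrArg _ (sum_congr rfl fun z hz => ?_))
  have hz := mem_Ico.1 hz
  simp only [RelEmbedding.coe_toEmbedding]
  rw [charPoly_map f hf hρ, ih _ ?_ hz.1 rfl, hρ x z hz.1, hρ z y hz.2.le]
  rw [← hn]
  exact card_lt_card (Icc_ssubset_Icc_right (hz.1.trans hz.2.le) le_rfl hz.2)

end Embedding

/-! ### Intervals of length one -/

section Covering

variable {S : Type*} [PartialOrder S] [LocallyFiniteOrder S] {ρ : S → ℕ} {x y : S}

theorem Ico_eq_of_covBy (h : x ⋖ y) : Ico x y = {x} := by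
  rw [← coe_inj, coe_Ico, h.Ico_eq, coe_singleton]

theorem Ioc_eq_of_covBy (h : x ⋖ y) : Ioc x y = {y} := by
  rw [← coe_inj, coe_Ioc, h.Ioc_eq, coe_singleton]

theorem moebius_of_covBy (h : x ⋖ y) : moebius x y = -1 := by
  rw [moebius_of_ne h.lt.ne, Ico_eq_of_covBy h]
  simp

theorem charPoly_of_covBy (h : x ⋖ y) (hρ : ρ y = ρ x + 1) :
    charPoly ρ x y = Polynomial.X - 1 := by
  classical
  rw [charPoly, ← Ico_insert_right h.le, sum_insert (by simp), Ico_eq_of_covBy h,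
    moebius_of_covBy h]
  simp [hρ]
  ring

theorem lowerHalf_one (f : ℤ[X]) : lowerHalf 1 f = Polynomial.C (f.coeff 0) := by
  ext i
  rw [coeff_lowerHalf, Polynomial.coeff_C]
  rcases i with _ | i
  · simp
  · rw [if_neg (by omega), if_neg (by omega)]

/-- The recursion has the single term t - 1, whose constant coefficient -1 is negated. This
evaluates the polynomials between a hyperplane and the ground set. -/
theorem kl_of_covBy (h : x ⋖ y) (hρ : ρ y = ρ x + 1) : kl ρ x y = 1 := by
  rw [kl_of_ne _ h.lt.ne, Ioc_eq_of_covBy h, sum_singleton, charPoly_of_covBy h hρ, hρ,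
    Nat.add_sub_cancel_left, lowerHalf_one]
  simp

theorem reflect_X_sub_one : ((Polynomial.X : ℤ[X]) - 1).reflect 1 = 1 - Polynomial.X := by
  have h1 : (Polynomial.X : ℤ[X]).reflect 1 = 1 := by simp
  have h2 : (1 : ℤ[X]).reflect 1 = Polynomial.X := by simp
  rw [sub_eq_add_neg, Polynomial.reflect_add, Polynomial.reflect_neg, h1, h2, sub_eq_add_neg]

theorem reflect_charPoly_of_covBy (h : x ⋖ y) (hρ : ρ y = ρ x + 1) :
    (charPoly ρ x y).reflect 1 = 1 - Polynomial.X := by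
  rw [charPoly_of_covBy h hρ, reflect_X_sub_one]

theorem invKL_of_covBy (h : x ⋖ y) (hρ : ρ y = ρ x + 1) : invKL ρ x y = 1 := by
  rw [invKL_of_ne _ h.lt.ne, Ico_eq_of_covBy h, sum_singleton, hρ,
    Nat.add_sub_cancel_left, lowerHalf_one, reflect_charPoly_of_covBy h hρ]
  simp

end Covering

/-! ### Degrees and coefficients of the interval polynomials -/

section Degree

variable {S : Type*} [PartialOrder S] [LocallyFiniteOrder S] {ρ : S → ℕ}

theorem natDegree_charPoly_le (hρ : Monotone ρ) (x y : S) :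
    (charPoly ρ x y).natDegree ≤ ρ y - ρ x := by
  refine Polynomial.natDegree_sum_le_of_forall_le _ _ fun z hz => ?_
  refine (Polynomial.natDegree_C_mul_X_pow_le _ _).trans ?_
  have := hρ (mem_Icc.1 hz).1
  omega

theorem coeff_kl_of_ne {x y : S} (h : x ≠ y) (i : ℕ) :
    (kl ρ x y).coeff i = if 2 * i < ρ y - ρ x then
      -(∑ z ∈ Ioc x y, charPoly ρ x z * kl ρ z y).coeff i else 0 := by
  rw [kl_of_ne _ h, Polynomial.coeff_neg, coeff_lowerHalf]
  split_ifs <;> simp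

theorem coeff_invKL_of_ne {x y : S} (h : x ≠ y) (i : ℕ) :
    (invKL ρ x y).coeff i = if 2 * i < ρ y - ρ x then
      -(-1) ^ (ρ y - ρ x) * (∑ z ∈ Ico x y,
      (-1) ^ (ρ z - ρ x) * invKL ρ x z * (charPoly ρ z y).reflect (ρ y - ρ z)).coeff i
      else 0 := by
  have hsgn : -(-1 : ℤ[X]) ^ (ρ y - ρ x) = Polynomial.C (-(-1) ^ (ρ y - ρ x)) := by simp
  rw [invKL_of_ne _ h, hsgn, Polynomial.coeff_C_mul, coeff_lowerHalf]
  split_ifs <;> simp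

end Degree

/-! ### Product with a two-element chain -/

section ProdBool

variable {S T : Type*} [PartialOrder S] [PartialOrder T] (e : S × Bool ≃o T)

/-- The copy of `S` in `S × Bool` at a fixed second coordinate. -/
def prodBoolEmb (b : Bool) : S ↪o T :=
  OrderEmbedding.ofMapLEIff (fun x => e (x, b)) fun x y => by
    rw [e.le_iff_le, Prod.mk_le_mk]
    simp

@[simp] theorem prodBoolEmb_apply (b : Bool) (x : S) : prodBoolEmb e b x = e (x, b) := rfl

theorem prodBoolEmb_ordConnected (b : Bool) : (Set.range (prodBoolEmb e b)).OrdConnected := by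
  refine ⟨?_⟩
  rintro _ ⟨x, rfl⟩ _ ⟨y, rfl⟩ t ht
  obtain ⟨⟨z, c⟩, rfl⟩ := e.surjective t
  simp only [prodBoolEmb_apply, Set.mem_Icc, e.le_iff_le, Prod.mk_le_mk] at ht
  exact ⟨z, by rw [prodBoolEmb_apply, le_antisymm ht.1.2 ht.2.2]⟩

theorem prodBoolEmb_rank {ρ : S → ℕ} {ρ' : T → ℕ} (h0 : ∀ x, ρ' (e (x, false)) = ρ x)
    (h1 : ∀ x, ρ' (e (x, true)) = ρ x + 1) (b : Bool) (x y : S) (_ : x ≤ y) :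
    ρ' (prodBoolEmb e b y) - ρ' (prodBoolEmb e b x) = ρ y - ρ x := by
  cases b <;> simp [h0, h1]

variable [LocallyFiniteOrder S] [LocallyFiniteOrder T]

/-- An interval from the lower to the upper layer consists of two copies of [x, y]. In the half-open
versions below, the missing endpoint is lost only in its own layer. -/
theorem sum_Icc_prodBool {R : Type*} [AddCommMonoid R] (g : T → R) (x y : S) :
    ∑ t ∈ Icc (e (x, false)) (e (y, true)), g t =
      ∑ z ∈ Icc x y, g (e (z, false)) + ∑ z ∈ Icc x y, g (e (z, true)) := by
  classical
  have h : Icc (e (x, false)) (e (y, true)) =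
      (Icc x y).map (prodBoolEmb e false).toEmbedding ∪
        (Icc x y).map (prodBoolEmb e true).toEmbedding := by
    ext t
    obtain ⟨⟨z, c⟩, rfl⟩ := e.surjective t
    cases c <;> simp [Prod.mk_le_mk]
  rw [h, sum_union, sum_map, sum_map]
  · rfl
  · rw [disjoint_left]
    intro t
    obtain ⟨⟨z, c⟩, rfl⟩ := e.surjective t
    cases c <;> simp

theorem sum_Ioc_prodBool {R : Type*} [AddCommMonoid R] (g : T → R) (x y : S) :
    ∑ t ∈ Ioc (e (x, false)) (e (y, true)), g t =
      ∑ z ∈ Ioc x y, g (e (z, false)) + ∑ z ∈ Icc x y, g (e (z, true)) := by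
  classical
  have h : Ioc (e (x, false)) (e (y, true)) =
      (Ioc x y).map (prodBoolEmb e false).toEmbedding ∪
        (Icc x y).map (prodBoolEmb e true).toEmbedding := by
    ext t
    obtain ⟨⟨z, c⟩, rfl⟩ := e.surjective t
    cases c
    · simp [Prod.mk_le_mk, Prod.mk_lt_mk]
    · simpa [Prod.mk_le_mk, Prod.mk_lt_mk] using fun _ h => le_of_lt h
  rw [h, sum_union, sum_map, sum_map]
  · rfl
  · rw [disjoint_left]
    intro t
    obtain ⟨⟨z, c⟩, rfl⟩ := e.surjective t
    cases c <;> simp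

theorem sum_Ico_prodBool {R : Type*} [AddCommMonoid R] (g : T → R) (x y : S) :
    ∑ t ∈ Ico (e (x, false)) (e (y, true)), g t =
      ∑ z ∈ Icc x y, g (e (z, false)) + ∑ z ∈ Ico x y, g (e (z, true)) := by
  classical
  have h : Ico (e (x, false)) (e (y, true)) =
      (Icc x y).map (prodBoolEmb e false).toEmbedding ∪
        (Ico x y).map (prodBoolEmb e true).toEmbedding := by
    ext t
    obtain ⟨⟨z, c⟩, rfl⟩ := e.surjective t
    cases c
    · simpa [Prod.mk_le_mk, Prod.mk_lt_mk] using fun _ h => le_of_lt h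
    · simp [Prod.mk_le_mk, Prod.mk_lt_mk]
  rw [h, sum_union, sum_map, sum_map]
  · rfl
  · rw [disjoint_left]
    intro t
    obtain ⟨⟨z, c⟩, rfl⟩ := e.surjective t
    cases c <;> simp

/-- By induction, the upper-layer terms with z < y cancel those of the lower layer, and only the
lower copy of y survives. -/
theorem moebius_prodBool {x y : S} (hxy : x ≤ y) :
    moebius (e (x, false)) (e (y, true)) = -moebius x y := by
  classical
  induction hn : (Icc x y).card using Nat.strong_induction_on generalizing y with
  | _ n ih =>
  rw [moebius_of_ne (by simp), sum_Ico_prodBool, ← Ico_insert_right hxy, sum_insert (by simp)]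
  have h1 : ∀ z b, moebius (e (x, b)) (e (z, b)) = moebius x z := fun z b =>
    moebius_map (prodBoolEmb e b) (prodBoolEmb_ordConnected e b) x z
  rw [sum_congr (s₁ := Ico x y) rfl fun z hz => ih _ ?_ (mem_Ico.1 hz).1 rfl]
  · simp [h1]
  · have hz := mem_Ico.1 hz
    rw [← hn]
    exact card_lt_card (Icc_ssubset_Icc_right (hz.1.trans hz.2.le) le_rfl hz.2)

variable {ρ : S → ℕ} {ρ' : T → ℕ} (hρ : Monotone ρ) (h0 : ∀ x, ρ' (e (x, false)) = ρ x)
  (h1 : ∀ x, ρ' (e (x, true)) = ρ x + 1)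

include h0 h1

theorem charPoly_prodBool_of_eq (b : Bool) (x y : S) :
    charPoly ρ' (e (x, b)) (e (y, b)) = charPoly ρ x y :=
  charPoly_map (prodBoolEmb e b) (prodBoolEmb_ordConnected e b) (prodBoolEmb_rank e h0 h1 b) x y

theorem kl_prodBool_of_eq (b : Bool) {x y : S} (hxy : x ≤ y) :
    kl ρ' (e (x, b)) (e (y, b)) = kl ρ x y :=
  kl_map (prodBoolEmb e b) (prodBoolEmb_ordConnected e b) (prodBoolEmb_rank e h0 h1 b) hxy

theorem invKL_prodBool_of_eq (b : Bool) {x y : S} (hxy : x ≤ y) :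
    invKL ρ' (e (x, b)) (e (y, b)) = invKL ρ x y :=
  invKL_map (prodBoolEmb e b) (prodBoolEmb_ordConnected e b) (prodBoolEmb_rank e h0 h1 b) hxy

include hρ

/-- Each z contributes twice: the lower copy has one more unit of corank, hence a factor t, and the
upper copy has the opposite Möbius value. -/
theorem charPoly_prodBool (x y : S) :
    charPoly ρ' (e (x, false)) (e (y, true)) = (Polynomial.X - 1) * charPoly ρ x y := by
  rw [charPoly, sum_Icc_prodBool, charPoly, mul_sum, ← sum_add_distrib]
  refine sum_congr rfl fun z hz => ?_
  have hz := mem_Icc.1 hz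
  have h2 : moebius (e (x, false)) (e (z, false)) = moebius x z :=
    moebius_map (prodBoolEmb e false) (prodBoolEmb_ordConnected e false) x z
  rw [h2, moebius_prodBool e hz.1, h0, h1, h1, Nat.add_sub_add_right,
    Nat.sub_add_comm (hρ hz.2), pow_succ, map_neg]
  ring

theorem kl_prodBool {x y : S} (hxy : x ≤ y) :
    kl ρ' (e (x, false)) (e (y, true)) = kl ρ x y := by
  classical
  induction hn : (Icc x y).card using Nat.strong_induction_on generalizing x with
  | _ n ih =>
  have hIH : ∀ z ∈ Ioc x y, kl ρ' (e (z, false)) (e (y, true)) = kl ρ z y := by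
    intro z hz
    have hz := mem_Ioc.1 hz
    refine ih _ ?_ hz.2 rfl
    rw [← hn]
    exact card_lt_card (Icc_ssubset_Icc_left (hz.1.le.trans hz.2) hz.1 le_rfl)
  -- For z > x the two copies contribute with factors 1 and t - 1, which add up to t. For z = x only
  -- the upper copy lies in the half-open interval.
  have key : ∑ t ∈ Ioc (e (x, false)) (e (y, true)),
      charPoly ρ' (e (x, false)) t * kl ρ' t (e (y, true)) =
      (Polynomial.X - 1) * kl ρ x y +
        Polynomial.X * ∑ z ∈ Ioc x y, charPoly ρ x z * kl ρ z y := by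
    rw [sum_Ioc_prodBool, ← Ioc_insert_left hxy, sum_insert (by simp),
      charPoly_prodBool e hρ h0 h1, kl_prodBool_of_eq e h0 h1 true hxy, charPoly_self, mul_one,
      mul_sum, add_left_comm, ← sum_add_distrib]
    refine congrArg _ (sum_congr rfl fun z hz => ?_)
    rw [hIH z hz, charPoly_prodBool_of_eq e h0 h1, charPoly_prodBool e hρ h0 h1,
      kl_prodBool_of_eq e h0 h1 true (mem_Ioc.1 hz).2]
    ring
  have hr := hρ hxy
  ext i
  rw [coeff_kl_of_ne (by simp), key, h0, h1]
  -- A trivial interval has P = 1 by convention and not by the recursion, so it is checked by hand.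
  by_cases hx : x = y
  · subst hx
    rcases i with _ | i
    · simp
    · rw [if_neg (by omega)]
      simp [Polynomial.coeff_one]
  rw [sub_mul, one_mul, Polynomial.coeff_add, Polynomial.coeff_sub]
  split_ifs with hi
  · rcases i with _ | i
    · simp
    -- Degree i is below half the rank of [x, y], so there the recursion sum is minus P; the two
    -- multiples of t cancel and P remains.
    · rw [Polynomial.coeff_X_mul, Polynomial.coeff_X_mul, coeff_kl_of_ne hx i, if_pos (by omega)]
      ring
  · rw [coeff_kl_of_ne hx i, if_neg (by omega)]

/-- Reflection is multiplicative when the degree bounds add up, and it turns t - 1 into 1 - t. -/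
theorem reflect_charPoly_prodBool {x y : S} (hxy : x ≤ y) :
    (charPoly ρ' (e (x, false)) (e (y, true))).reflect (ρ y + 1 - ρ x) =
      (1 - Polynomial.X) * (charPoly ρ x y).reflect (ρ y - ρ x) := by
  rw [charPoly_prodBool e hρ h0 h1, Nat.sub_add_comm (hρ hxy), add_comm (ρ y - ρ x) 1,
    Polynomial.reflect_mul _ _ (by simpa using Polynomial.natDegree_X_sub_C_le (1 : ℤ))
      (natDegree_charPoly_le hρ x y), reflect_X_sub_one]

theorem invKL_prodBool {x y : S} (hxy : x ≤ y) :
    invKL ρ' (e (x, false)) (e (y, true)) = invKL ρ x y := by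
  classical
  induction hn : (Icc x y).card using Nat.strong_induction_on generalizing y with
  | _ n ih =>
  have hIH : ∀ z ∈ Ico x y, invKL ρ' (e (x, false)) (e (z, true)) = invKL ρ x z := by
    intro z hz
    have hz := mem_Ico.1 hz
    refine ih _ ?_ hz.1 rfl
    rw [← hn]
    exact card_lt_card (Icc_ssubset_Icc_right (hz.1.trans hz.2.le) le_rfl hz.2)
  -- For z < y the lower copy has factor 1 - t, and the upper copy has factor -1 because its rank is
  -- one larger; the sum is -t. For z = y only the lower copy occurs.
  have key : ∑ t ∈ Ico (e (x, false)) (e (y, true)),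
      (-1) ^ (ρ' t - ρ' (e (x, false))) * invKL ρ' (e (x, false)) t *
        (charPoly ρ' t (e (y, true))).reflect (ρ' (e (y, true)) - ρ' t) =
      (-1) ^ (ρ y - ρ x) * (1 - Polynomial.X) * invKL ρ x y -
        Polynomial.X * ∑ z ∈ Ico x y,
          (-1) ^ (ρ z - ρ x) * invKL ρ x z * (charPoly ρ z y).reflect (ρ y - ρ z) := by
    rw [sum_Ico_prodBool, ← Ico_insert_right hxy, sum_insert (by simp), h0, h0, h1,
      reflect_charPoly_prodBool e hρ h0 h1 le_rfl, invKL_prodBool_of_eq e h0 h1 false hxy,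
      charPoly_self, mul_sum, add_assoc, ← sum_add_distrib, sub_eq_add_neg _ (∑ _ ∈ _, _),
      ← sum_neg_distrib]
    have hone : (1 : ℤ[X]).reflect (ρ y - ρ y) = 1 := by simp
    rw [hone]
    refine congrArg₂ _ (by ring) (sum_congr rfl fun z hz => ?_)
    have hz' := mem_Ico.1 hz
    rw [hIH z hz, invKL_prodBool_of_eq e h0 h1 false hz'.1, h0, h1,
      reflect_charPoly_prodBool e hρ h0 h1 hz'.2.le, charPoly_prodBool_of_eq e h0 h1 true,
      Nat.add_sub_add_right, Nat.sub_add_comm (hρ hz'.1), pow_succ]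
    ring
  have hr := hρ hxy
  have hsq : ∀ n : ℕ, (-1 : ℤ) ^ n * (-1) ^ n = 1 := fun n => by rw [← mul_pow]; simp
  have hsgn : ((-1 : ℤ[X]) ^ (ρ y - ρ x)) = Polynomial.C ((-1) ^ (ρ y - ρ x)) := by simp
  ext i
  rw [coeff_invKL_of_ne (by simp), key, h0, h1, Nat.sub_add_comm hr, pow_succ]
  by_cases hx : x = y
  · subst hx
    rcases i with _ | i
    · simp
    · rw [if_neg (by omega)]
      simp [Polynomial.coeff_one]
  rw [hsgn, mul_assoc, Polynomial.coeff_sub, Polynomial.coeff_C_mul, sub_mul, one_mul,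
    Polynomial.coeff_sub]
  have hs := hsq (ρ y - ρ x)
  split_ifs with hi
  · rcases i with _ | i
    · simp only [Polynomial.coeff_X_mul_zero]
      linear_combination (invKL ρ x y).coeff 0 * hs
    · rw [Polynomial.coeff_X_mul, Polynomial.coeff_X_mul, coeff_invKL_of_ne hx i,
        if_pos (by omega)]
      set s := (-1 : ℤ) ^ (ρ y - ρ x)
      set a := (∑ z ∈ Ico x y, (-1) ^ (ρ z - ρ x) * invKL ρ x z *
        (charPoly ρ z y).reflect (ρ y - ρ z)).coeff i
      linear_combination ((invKL ρ x y).coeff (i + 1) + s * a) * hs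
  · rw [coeff_invKL_of_ne hx i, if_neg (by omega)]

end ProdBool

end RankedPoset

namespace Matroid

open RankedPoset

variable {α : Type u} {M : Matroid α}

/-! ### Flats and ranks of minors -/

theorem rkNat_eq_of_eRk_eq {β : Type v} {N : Matroid β} {A : Set α} {B : Set β}
    (h : M.eRk A = N.eRk B) : M.rkNat A = N.rkNat B := by
  rw [rkNat, rkNat, h]

theorem rkNat_mono (M : Matroid α) [M.Finite] {A B : Set α} (h : A ⊆ B) :
    M.rkNat A ≤ M.rkNat B := by
  have := M.eRk_mono h
  rw [← coe_rkNat, ← coe_rkNat] at this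
  exact_mod_cast this

theorem isFlat_restrict_iff {F A : Set α} (hF : M.IsFlat F) :
    (M ↾ F).IsFlat A ↔ A ⊆ F ∧ M.IsFlat A := by
  constructor
  · intro h
    have hA : A ⊆ F := h.subset_ground
    refine ⟨hA, ?_⟩
    have hc := h.closure
    rw [M.restrict_closure_eq hA hF.subset_ground, Set.inter_eq_left.2] at hc
    · exact isFlat_iff_closure_eq.2 hc
    · exact (M.closure_subset_closure hA).trans hF.closure.subset
  · rintro ⟨hA, h⟩
    rw [isFlat_iff_closure_eq, M.restrict_closure_eq hA hF.subset_ground, h.closure,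
      Set.inter_eq_left.2 hA]

theorem isFlat_contract_iff {F A : Set α} (hF : M.IsFlat F) :
    (M ／ F).IsFlat A ↔ Disjoint A F ∧ M.IsFlat (A ∪ F) := by
  rw [isFlat_iff_closure_eq, contract_closure_eq]
  constructor
  · intro h
    have hd : Disjoint A F := by
      rw [← h]
      exact Set.disjoint_sdiff_left
    refine ⟨hd, ?_⟩
    rw [isFlat_iff_closure_eq]
    have hsub : F ⊆ M.closure (A ∪ F) :=
      hF.closure.symm.subset.trans (M.closure_subset_closure Set.subset_union_right)
    conv_rhs => rw [← h, Set.sdiff_union_of_subset hsub]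
  · rintro ⟨hd, h⟩
    rw [h.closure, Set.union_sdiff_right, hd.sdiff_eq_left]

/-- A basis of F extends to a basis of the union, and the added elements form a basis of A in the
contraction. -/
theorem rkNat_contract_add [M.Finite] (F A : Set α) (hd : Disjoint A F) :
    (M ／ F).rkNat A + M.rkNat F = M.rkNat (A ∪ F) := by
  obtain ⟨I, hI⟩ := M.exists_isBasis' F
  obtain ⟨J, hJ, hIJ⟩ := hI.indep.subset_isBasis'_of_subset
    (hI.subset.trans (Set.subset_union_right (s := A)))
  have hJF : J ∩ F = I := by
    refine Set.Subset.antisymm ?_ (Set.subset_inter hIJ hI.subset)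
    rintro x ⟨hxJ, hxF⟩
    by_contra hxI
    exact hI.insert_not_indep ⟨hxF, hxI⟩ (hJ.indep.subset (Set.insert_subset hxJ hIJ))
  have hb := hJ.contract_isBasis' hI (hJ.indep.subset
    (Set.union_subset Set.sdiff_subset hIJ))
  rw [Set.union_sdiff_right, hd.sdiff_eq_left] at hb
  have h1 := hb.eRk_eq_encard
  have h2 := hI.eRk_eq_encard
  have h3 := hJ.eRk_eq_encard
  have h4 := Set.encard_sdiff_add_encard_inter J F
  rw [hJF, ← h1, ← h2, ← h3, ← coe_rkNat, ← coe_rkNat, ← coe_rkNat] at h4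
  exact_mod_cast h4

/-! ### The ranked lattice of flats -/

/-- The greatest flat. -/
def topFlat (M : Matroid α) : M.FlatPoset := ⟨M.E, M.ground_isFlat⟩

/-- The rank function on the lattice of flats. -/
noncomputable def flatRank (M : Matroid α) (F : M.FlatPoset) : ℕ := M.rkNat F.1

theorem flatRank_mono (M : Matroid α) [M.Finite] : Monotone M.flatRank :=
  fun _ _ h => M.rkNat_mono h

theorem minFlat_le (F : M.FlatPoset) : M.minFlat ≤ F := F.2.loops_subset

theorem le_topFlat (F : M.FlatPoset) : F ≤ M.topFlat := F.2.subset_ground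

theorem flatRank_topFlat (M : Matroid α) : M.flatRank M.topFlat = M.rankNat := rfl

theorem flatRank_minFlat (M : Matroid α) : M.flatRank M.minFlat = 0 := by
  simp [flatRank, minFlat, rkNat]

theorem minFlat_val (h : M.loops = ∅) : M.minFlat.1 = ∅ := h

/-- The lattice of flats of a restriction to a flat, as a lower interval of the lattice of
flats. -/
def restrictFlatEmb (F : M.FlatPoset) : (M ↾ F.1).FlatPoset ↪o M.FlatPoset :=
  OrderEmbedding.ofMapLEIff (fun A => ⟨A.1, ((isFlat_restrict_iff F.2).1 A.2).2⟩)
    fun _ _ => Iff.rfl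

/-- The lattice of flats of a contraction of a flat, as an upper interval of the lattice of
flats. -/
def contractFlatEmb (F : M.FlatPoset) : (M ／ F.1).FlatPoset ↪o M.FlatPoset :=
  OrderEmbedding.ofMapLEIff (fun A => ⟨A.1 ∪ F.1, ((isFlat_contract_iff F.2).1 A.2).2⟩)
    fun A B => by
      refine ⟨fun h x hx => ?_, fun h => Set.union_subset_union_left _ h⟩
      exact (h (Or.inl hx)).resolve_right
        (((isFlat_contract_iff F.2).1 A.2).1.notMem_of_mem_left hx)

theorem restrictFlatEmb_ordConnected (F : M.FlatPoset) :
    (Set.range (restrictFlatEmb F)).OrdConnected := by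
  refine ⟨?_⟩
  rintro _ - _ ⟨B, rfl⟩ t ht
  exact ⟨⟨t.1, (isFlat_restrict_iff F.2).2 ⟨Set.Subset.trans ht.2 B.2.subset_ground, t.2⟩⟩, rfl⟩

theorem contractFlatEmb_ordConnected (F : M.FlatPoset) :
    (Set.range (contractFlatEmb F)).OrdConnected := by
  refine ⟨?_⟩
  rintro _ ⟨A, rfl⟩ _ - t ht
  have hFt : F.1 ⊆ t.1 := Set.Subset.trans Set.subset_union_right ht.1
  have hu : t.1 \ F.1 ∪ F.1 = t.1 := Set.sdiff_union_of_subset hFt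
  exact ⟨⟨t.1 \ F.1, (isFlat_contract_iff F.2).2 ⟨Set.disjoint_sdiff_left, hu.symm ▸ t.2⟩⟩,
    Subtype.ext hu⟩

theorem flatRank_restrictFlatEmb (F : M.FlatPoset) (A : (M ↾ F.1).FlatPoset) :
    M.flatRank (restrictFlatEmb F A) = (M ↾ F.1).flatRank A :=
  rkNat_eq_of_eRk_eq (M.restrict_eRk_eq A.2.subset_ground).symm

theorem flatRank_contractFlatEmb [M.Finite] (F : M.FlatPoset) (A : (M ／ F.1).FlatPoset) :
    M.flatRank (contractFlatEmb F A) = (M ／ F.1).flatRank A + M.flatRank F :=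
  (rkNat_contract_add F.1 A.1 ((isFlat_contract_iff F.2).1 A.2).1).symm

theorem restrictFlatEmb_minFlat (F : M.FlatPoset) :
    restrictFlatEmb F (M ↾ F.1).minFlat = M.minFlat := by
  refine Subtype.ext ?_
  change (M ↾ F.1).closure ∅ = M.closure ∅
  rw [M.restrict_closure_eq (Set.empty_subset _) F.2.subset_ground, Set.inter_eq_left]
  exact F.2.loops_subset

theorem restrictFlatEmb_topFlat (F : M.FlatPoset) :
    restrictFlatEmb F (M ↾ F.1).topFlat = F := rfl

theorem contractFlatEmb_minFlat (F : M.FlatPoset) :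
    contractFlatEmb F (M ／ F.1).minFlat = F := by
  refine Subtype.ext ?_
  change (M ／ F.1).closure ∅ ∪ F.1 = F.1
  rw [contract_closure_eq, Set.empty_union, F.2.closure]
  simp

theorem contractFlatEmb_topFlat (F : M.FlatPoset) :
    contractFlatEmb F (M ／ F.1).topFlat = M.topFlat :=
  Subtype.ext (Set.sdiff_union_of_subset F.2.subset_ground)

theorem loops_restrict_flat (h : M.loops = ∅) (F : M.FlatPoset) : (M ↾ F.1).loops = ∅ := by
  rw [restrict_loops_eq F.2.subset_ground, h, Set.empty_inter]

/-- A flat is its own closure, so contracting it creates no loops. For this reason the Z-polynomial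
is read off the lattice of flats without any assumption on loops. -/
theorem loops_contract_flat (F : M.FlatPoset) : (M ／ F.1).loops = ∅ := by
  rw [contract_loops_eq, F.2.closure, Set.sdiff_self]

theorem minFlat_eq_topFlat_iff (h : M.loops = ∅) [M.Finite] :
    M.minFlat = M.topFlat ↔ M.rankNat = 0 := by
  have h0 : M.rankNat = 0 ↔ M.E = ∅ := by
    rw [rankNat, ← Nat.cast_eq_zero (R := ℕ∞), coe_rkNat, eRk_eq_zero_iff, h,
      Set.subset_empty_iff]
  rw [h0, Subtype.ext_iff, minFlat_val h]
  exact eq_comm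

/-! ### Bridges to the polynomials of the lattice of flats -/

theorem charPolynomial_eq [M.Finite] (h : M.loops = ∅) :
    M.charPolynomial = charPoly M.flatRank M.minFlat M.topFlat := by
  classical
  let _ := Fintype.ofFinite M.FlatPoset
  rw [charPolynomial, if_pos h, finsum_eq_sum_of_fintype, charPoly]
  have hI : Finset.Icc M.minFlat M.topFlat = Finset.univ := by
    ext F
    simp [minFlat_le, le_topFlat]
  rw [hI]
  refine Finset.sum_congr rfl fun F _ => ?_
  rw [moebius]
  congr!

theorem charPolynomial_restrict [M.Finite] (h : M.loops = ∅) (F : M.FlatPoset)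
    [(M ↾ F.1).Finite] : (M ↾ F.1).charPolynomial = charPoly M.flatRank M.minFlat F := by
  rw [charPolynomial_eq (loops_restrict_flat h F), ← charPoly_map (restrictFlatEmb F)
    (restrictFlatEmb_ordConnected F) (ρ' := M.flatRank), restrictFlatEmb_minFlat,
    restrictFlatEmb_topFlat]
  intro A B _
  rw [flatRank_restrictFlatEmb, flatRank_restrictFlatEmb]

theorem charPolynomial_contract [M.Finite] (F : M.FlatPoset) :
    (M ／ F.1).charPolynomial = charPoly M.flatRank F M.topFlat := by
  rw [charPolynomial_eq (loops_contract_flat F), ← charPoly_map (contractFlatEmb F)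
    (contractFlatEmb_ordConnected F) (ρ' := M.flatRank), contractFlatEmb_minFlat,
    contractFlatEmb_topFlat]
  intro A B _
  rw [flatRank_contractFlatEmb, flatRank_contractFlatEmb, Nat.add_sub_add_right]

theorem kl_contract [M.Finite] (F : M.FlatPoset) :
    kl (M ／ F.1).flatRank (M ／ F.1).minFlat (M ／ F.1).topFlat =
      kl M.flatRank F M.topFlat := by
  rw [← kl_map (contractFlatEmb F) (contractFlatEmb_ordConnected F) (ρ' := M.flatRank) _
    (minFlat_le _), contractFlatEmb_minFlat, contractFlatEmb_topFlat]
  intro A B _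
  rw [flatRank_contractFlatEmb, flatRank_contractFlatEmb, Nat.add_sub_add_right]

theorem invKL_restrict [M.Finite] (F : M.FlatPoset) [(M ↾ F.1).Finite] :
    invKL (M ↾ F.1).flatRank (M ↾ F.1).minFlat (M ↾ F.1).topFlat =
      invKL M.flatRank M.minFlat F := by
  rw [← invKL_map (restrictFlatEmb F) (restrictFlatEmb_ordConnected F) (ρ' := M.flatRank) _
    (minFlat_le _), restrictFlatEmb_minFlat, restrictFlatEmb_topFlat]
  intro A B _
  rw [flatRank_restrictFlatEmb, flatRank_restrictFlatEmb]

theorem ground_eq_empty_of_rankNat_eq_zero [M.Finite] (h : M.loops = ∅) (h0 : M.rankNat = 0) :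
    M.E = ∅ := by
  have := (minFlat_eq_topFlat_iff h).2 h0
  rw [Subtype.ext_iff, minFlat_val h] at this
  exact this.symm

/-- Without loops the least flat is ∅, so the nonempty flats are exactly the half-open interval of
the poset recursion. Induction on the size of the ground set applies to the contractions, which are
again loopless. -/
theorem klPolynomial_eq [hM : M.Finite] (h : M.loops = ∅) :
    M.klPolynomial = kl M.flatRank M.minFlat M.topFlat := by
  classical
  induction hn : M.E.ncard using Nat.strong_induction_on generalizing M with
  | _ n ih =>
  rw [klPolynomial]
  by_cases h0 : M.rankNat = 0
  · rw [if_pos h0, if_pos (ground_eq_empty_of_rankNat_eq_zero h h0),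
      (minFlat_eq_topFlat_iff h).2 h0, kl_self]
  let _ := Fintype.ofFinite M.FlatPoset
  rw [if_neg h0, kl_of_ne _ (mt (minFlat_eq_topFlat_iff h).1 h0), finsum_eq_sum_of_fintype,
    flatRank_topFlat, flatRank_minFlat, Nat.sub_zero]
  have hmem : ∀ F : M.FlatPoset, F ∈ Finset.Ioc M.minFlat M.topFlat ↔ F.1.Nonempty := by
    intro F
    rw [Finset.mem_Ioc, and_iff_left (le_topFlat F), (minFlat_le F).lt_iff_ne, Ne,
      Subtype.ext_iff, minFlat_val h, Set.nonempty_iff_ne_empty, ne_comm]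
  rw [Finset.sum_subtype _ hmem]
  refine congrArg _ (congrArg _ (Finset.sum_congr rfl fun F _ => ?_))
  have := M.restrict_flat_finite F.1
  rw [charPolynomial_restrict h F.1, ih _ ?_ (loops_contract_flat F.1) rfl, kl_contract]
  obtain ⟨x, hx⟩ := F.2
  have hxE : x ∈ M.E := F.1.2.subset_ground hx
  rw [← hn]
  exact Set.ncard_lt_ncard ⟨Set.sdiff_subset, fun h => (h hxE).2 hx⟩ M.ground_finite

theorem invKLPolynomial_eq [hM : M.Finite] (h : M.loops = ∅) :
    M.invKLPolynomial = invKL M.flatRank M.minFlat M.topFlat := by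
  classical
  induction hn : M.E.ncard using Nat.strong_induction_on generalizing M with
  | _ n ih =>
  rw [invKLPolynomial]
  by_cases h0 : M.rankNat = 0
  · rw [if_pos h0, if_pos (ground_eq_empty_of_rankNat_eq_zero h h0),
      (minFlat_eq_topFlat_iff h).2 h0, invKL_self]
  let _ := Fintype.ofFinite M.FlatPoset
  rw [if_neg h0, invKL_of_ne _ (mt (minFlat_eq_topFlat_iff h).1 h0), finsum_eq_sum_of_fintype,
    flatRank_topFlat, flatRank_minFlat, Nat.sub_zero]
  have hmem : ∀ F : M.FlatPoset, F ∈ Finset.Ico M.minFlat M.topFlat ↔ F.1 ≠ M.E := by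
    intro F
    rw [Finset.mem_Ico, and_iff_right (minFlat_le F), (le_topFlat F).lt_iff_ne, Ne,
      Subtype.ext_iff]
    rfl
  rw [Finset.sum_subtype _ hmem]
  refine congrArg _ (congrArg _ (Finset.sum_congr rfl fun F _ => ?_))
  have := M.restrict_flat_finite F.1
  rw [charPolynomial_contract F.1, ih _ ?_ (loops_restrict_flat h F.1) rfl, invKL_restrict]
  · rfl
  rw [← hn]
  exact Set.ncard_lt_ncard (F.1.2.subset_ground.ssubset_of_ne F.2) M.ground_finite

theorem zPolynomial_eq [M.Finite] [Fintype M.FlatPoset] :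
    M.zPolynomial = ∑ F : M.FlatPoset,
      Polynomial.X ^ M.flatRank F * kl M.flatRank F M.topFlat := by
  rw [zPolynomial, finsum_eq_sum_of_fintype]
  refine Finset.sum_congr rfl fun F _ => ?_
  rw [klPolynomial_eq (loops_contract_flat F), kl_contract]
  rfl

/-- Every flat contains the loops, so each restriction has a loop and its characteristic polynomial
vanishes. -/
theorem klPolynomial_of_loops [hM : M.Finite] (h : M.loops ≠ ∅) : M.klPolynomial = 0 := by
  rw [klPolynomial]
  by_cases h0 : M.rankNat = 0
  · rw [if_pos h0, if_neg]
    rintro hE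
    exact h (Set.subset_empty_iff.1 (hE ▸ M.loops_subset_ground))
  rw [if_neg h0, finsum_eq_zero_of_forall_eq_zero, neg_eq_zero]
  · ext i
    simp [coeff_lowerHalf]
  intro F
  have := M.restrict_flat_finite F.1
  rw [charPolynomial, if_neg, zero_mul]
  rwa [restrict_loops_eq F.1.2.subset_ground, Set.inter_eq_left.2 F.1.2.loops_subset]

/-- Here the characteristic polynomials belong to loopless contractions and need not vanish.
Induction kills the other factor, since restrictions to flats keep the loops. -/
theorem invKLPolynomial_of_loops [hM : M.Finite] (h : M.loops ≠ ∅) : M.invKLPolynomial = 0 := by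
  induction hn : M.E.ncard using Nat.strong_induction_on generalizing M with
  | _ n ih =>
  rw [invKLPolynomial]
  by_cases h0 : M.rankNat = 0
  · rw [if_pos h0, if_neg]
    rintro hE
    exact h (Set.subset_empty_iff.1 (hE ▸ M.loops_subset_ground))
  rw [if_neg h0, finsum_eq_zero_of_forall_eq_zero]
  · ext i
    simp [lowerHalf]
  intro F
  have := M.restrict_flat_finite F.1
  rw [ih _ ?_ ?_ rfl, mul_zero, zero_mul]
  · rw [← hn]
    exact Set.ncard_lt_ncard (F.1.2.subset_ground.ssubset_of_ne F.2) M.ground_finite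
  · rwa [restrict_loops_eq F.1.2.subset_ground, Set.inter_eq_left.2 F.1.2.loops_subset]

/-! ### Invariance under isomorphism of ranked lattices of flats -/

section Iso

variable {β : Type v} {N : Matroid β} (e : M.FlatPoset ≃o N.FlatPoset)

theorem orderIso_minFlat : e M.minFlat = N.minFlat :=
  le_antisymm (by rw [← e.apply_symm_apply N.minFlat, e.le_iff_le]; exact minFlat_le _)
    (minFlat_le _)

theorem orderIso_topFlat : e M.topFlat = N.topFlat :=
  le_antisymm (le_topFlat _)
    (by rw [← e.apply_symm_apply N.topFlat, e.le_iff_le]; exact le_topFlat _)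

theorem orderIso_ordConnected : (Set.range e.toOrderEmbedding).OrdConnected := by
  have : Set.range e.toOrderEmbedding = Set.univ := e.surjective.range_eq
  rw [this]
  exact Set.ordConnected_univ

variable [M.Finite] [N.Finite] (hr : ∀ F, N.flatRank (e F) = M.flatRank F)

include hr

theorem kl_orderIso (F : M.FlatPoset) :
    kl N.flatRank (e F) N.topFlat = kl M.flatRank F M.topFlat := by
  rw [← orderIso_topFlat e]
  exact kl_map e.toOrderEmbedding (orderIso_ordConnected e)
    (fun x y _ => by simp [hr]) (le_topFlat F)

theorem invKL_orderIso : invKL N.flatRank N.minFlat N.topFlat =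
    invKL M.flatRank M.minFlat M.topFlat := by
  rw [← orderIso_topFlat e, ← orderIso_minFlat e]
  exact invKL_map e.toOrderEmbedding (orderIso_ordConnected e)
    (fun x y _ => by simp [hr]) (le_topFlat _)

/-- The ranked lattice of flats cannot detect loops, hence the separate hypothesis on them. -/
theorem klPolynomial_orderIso (hM : M.loops = ∅ ↔ N.loops = ∅) :
    N.klPolynomial = M.klPolynomial := by
  by_cases h : M.loops = ∅
  · rw [klPolynomial_eq h, klPolynomial_eq (hM.1 h), ← orderIso_minFlat e, kl_orderIso e hr]
  · rw [klPolynomial_of_loops h, klPolynomial_of_loops (mt hM.2 h)]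

theorem invKLPolynomial_orderIso (hM : M.loops = ∅ ↔ N.loops = ∅) :
    N.invKLPolynomial = M.invKLPolynomial := by
  by_cases h : M.loops = ∅
  · rw [invKLPolynomial_eq h, invKLPolynomial_eq (hM.1 h), invKL_orderIso e hr]
  · rw [invKLPolynomial_of_loops h, invKLPolynomial_of_loops (mt hM.2 h)]

theorem zPolynomial_orderIso : N.zPolynomial = M.zPolynomial := by
  let _ := Fintype.ofFinite M.FlatPoset
  let _ := Fintype.ofFinite N.FlatPoset
  rw [zPolynomial_eq, zPolynomial_eq, ← e.toEquiv.sum_comp]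
  refine Finset.sum_congr rfl fun F _ => ?_
  change Polynomial.X ^ N.flatRank (e F) * kl N.flatRank (e F) N.topFlat = _
  rw [hr, kl_orderIso e hr]

end Iso

end Matroid

namespace Matroid

open RankedPoset

/-! ### Transport along a bijection of the ground types -/

section MapEquiv

variable {α : Type u} {β : Type v} (M : Matroid α) (f : α ≃ β)

theorem isFlat_mapEquiv_image_iff (F : Set α) : (M.mapEquiv f).IsFlat (f '' F) ↔ M.IsFlat F := by
  have hb : ∀ I X, (M.mapEquiv f).IsBasis (f '' I) (f '' X) ↔ M.IsBasis I X := by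
    intro I X
    rw [mapEquiv_eq_map, map_isBasis_iff']
    constructor
    · rintro ⟨I', X', h, hI, hX⟩
      rwa [f.injective.image_injective hI, f.injective.image_injective hX]
    · exact fun h => ⟨I, X, h, rfl, rfl⟩
  rw [isFlat_iff, isFlat_iff, mapEquiv_ground_eq, Set.image_subset_image_iff f.injective]
  refine and_congr_left fun _ => ⟨fun h I X hI hX => ?_, fun h I X hI hX => ?_⟩
  · exact (Set.image_subset_image_iff f.injective).1 (h ((hb I F).2 hI) ((hb I X).2 hX))
  · obtain ⟨I, rfl⟩ := f.surjective.image_surjective I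
    obtain ⟨X, rfl⟩ := f.surjective.image_surjective X
    exact Set.image_mono (h ((hb I F).1 hI) ((hb I X).1 hX))

/-- The isomorphism of lattices of flats induced by a bijection of the ground types. -/
def mapEquivFlatIso : M.FlatPoset ≃o (M.mapEquiv f).FlatPoset where
  toFun F := ⟨f '' F.1, (M.isFlat_mapEquiv_image_iff f F.1).2 F.2⟩
  invFun F := ⟨f.symm '' F.1, (M.isFlat_mapEquiv_image_iff f _).1 (by simpa using F.2)⟩
  left_inv F := by simp
  right_inv F := by simp
  map_rel_iff' := Set.image_subset_image_iff f.injective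

theorem flatRank_mapEquivFlatIso (F : M.FlatPoset) :
    (M.mapEquiv f).flatRank (M.mapEquivFlatIso f F) = M.flatRank F :=
  rkNat_eq_of_eRk_eq (M.eRk_map f.injective.injOn F.2.subset_ground)

theorem loops_mapEquiv_iff : M.loops = ∅ ↔ (M.mapEquiv f).loops = ∅ := by
  have h : f '' M.loops = (M.mapEquiv f).loops :=
    congrArg Subtype.val (orderIso_minFlat (M.mapEquivFlatIso f))
  rw [← h, Set.image_eq_empty]

variable [M.Finite]

theorem klPolynomial_mapEquiv : (M.mapEquiv f).klPolynomial = M.klPolynomial :=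
  klPolynomial_orderIso _ (M.flatRank_mapEquivFlatIso f) (M.loops_mapEquiv_iff f)

theorem invKLPolynomial_mapEquiv : (M.mapEquiv f).invKLPolynomial = M.invKLPolynomial :=
  invKLPolynomial_orderIso _ (M.flatRank_mapEquivFlatIso f) (M.loops_mapEquiv_iff f)

theorem zPolynomial_mapEquiv : (M.mapEquiv f).zPolynomial = M.zPolynomial :=
  zPolynomial_orderIso _ (M.flatRank_mapEquivFlatIso f)

end MapEquiv

/-! ### Adding a coloop -/

section AddColoop

variable {α : Type v} (N : Matroid α)

/-- The direct sum of a matroid and a coloop. -/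
def addColoop : Matroid (α ⊕ PUnit.{w + 1}) := N.sum (freeOn Set.univ)

instance addColoop_finite [N.Finite] : (addColoop.{v, w} N).Finite :=
  ⟨by
    rw [addColoop, sum_ground]
    exact (N.ground_finite.image _).union (Set.toFinite _)⟩

theorem isBasis_addColoop_iff {I X : Set (α ⊕ PUnit.{w + 1})} :
    N.addColoop.IsBasis I X ↔ N.IsBasis (Sum.inl ⁻¹' I) (Sum.inl ⁻¹' X) ∧
      (Sum.inr ⁻¹' I : Set PUnit.{w + 1}) = Sum.inr ⁻¹' X := by
  simp [addColoop]

theorem subset_ground_addColoop_iff {F : Set (α ⊕ PUnit.{w + 1})} :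
    F ⊆ N.addColoop.E ↔ Sum.inl ⁻¹' F ⊆ N.E := by
  simp only [addColoop, sum_ground, freeOn_ground, Set.image_univ]
  constructor
  · intro h x hx
    simpa using h hx
  · rintro h (x | x) hx
    · exact Or.inl ⟨x, h hx, rfl⟩
    · simp

theorem isFlat_addColoop_iff {F : Set (α ⊕ PUnit.{w + 1})} :
    N.addColoop.IsFlat F ↔ N.IsFlat (Sum.inl ⁻¹' F) := by
  rw [isFlat_iff, isFlat_iff, subset_ground_addColoop_iff]
  refine and_congr_left fun _ => ⟨fun h I X hI hX => ?_, fun h I X hI hX => ?_⟩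
  -- Bases in `N` are lifted by adjoining the coloop part of `F`, the same to the independent set
  -- and to the set it spans.
  · have hb : ∀ Y, N.IsBasis I Y → N.addColoop.IsBasis
        (Sum.inl '' I ∪ Sum.inr '' (Sum.inr ⁻¹' F)) (Sum.inl '' Y ∪ Sum.inr '' (Sum.inr ⁻¹' F)) := by
      intro Y hY
      rw [isBasis_addColoop_iff]
      simpa [Set.preimage_image_eq _ Sum.inl_injective,
        Set.preimage_image_eq _ Sum.inr_injective] using hY
    have h1 := hb _ hI
    rw [Set.image_preimage_inl_union_image_preimage_inr] at h1
    intro x hx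
    exact h h1 (hb _ hX) (Or.inl ⟨x, hx, rfl⟩)
  · rw [isBasis_addColoop_iff] at hI hX
    rintro (x | x) hx
    · exact h hI.1 hX.1 hx
    · have hx' : x ∈ (Sum.inr ⁻¹' X : Set PUnit.{w + 1}) := hx
      rw [← hX.2, hI.2] at hx'
      exact hx'

theorem encard_sum (X : Set (α ⊕ PUnit.{w + 1})) :
    X.encard = (Sum.inl ⁻¹' X : Set α).encard + (Sum.inr ⁻¹' X : Set PUnit.{w + 1}).encard := by
  conv_lhs => rw [← Set.image_preimage_inl_union_image_preimage_inr X]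
  rw [Set.encard_union_eq, Sum.inl_injective.encard_image, Sum.inr_injective.encard_image]
  rw [Set.disjoint_left]
  rintro _ ⟨x, -, rfl⟩ ⟨y, -, h⟩
  exact Sum.inr_ne_inl h

theorem eRk_addColoop {X : Set (α ⊕ PUnit.{w + 1})} (hX : Sum.inl ⁻¹' X ⊆ N.E) :
    N.addColoop.eRk X = N.eRk (Sum.inl ⁻¹' X) +
      (Sum.inr ⁻¹' X : Set PUnit.{w + 1}).encard := by
  obtain ⟨I, hI⟩ := N.addColoop.exists_isBasis X ((N.subset_ground_addColoop_iff).2 hX)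
  rw [hI.eRk_eq_encard, encard_sum]
  rw [isBasis_addColoop_iff] at hI
  rw [hI.1.eRk_eq_encard, hI.2]

/-- The flats of the direct sum of `N` and a coloop are the flats of `N` with or without the
coloop. -/
noncomputable def addColoopFlatIso : N.FlatPoset × Bool ≃o (addColoop.{v, w} N).FlatPoset where
  toFun A := ⟨{x | Sum.elim (· ∈ A.1.1) (fun _ => A.2 = true) x},
    N.isFlat_addColoop_iff.2 A.1.2⟩
  invFun F := (⟨Sum.inl ⁻¹' F.1, N.isFlat_addColoop_iff.1 F.2⟩,
    @decide (Sum.inr PUnit.unit ∈ F.1) (Classical.propDecidable _))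
  left_inv A := by
    refine Prod.ext (Subtype.ext rfl) ?_
    exact @Bool.decide_eq_true _ (Classical.propDecidable _)
  right_inv F := by
    refine Subtype.ext ?_
    ext (x | x)
    · rfl
    · simp
  map_rel_iff' := by
    rintro ⟨A, a⟩ ⟨B, b⟩
    rw [Prod.mk_le_mk]
    constructor
    · intro h
      refine ⟨fun x hx => h (a := Sum.inl x) hx, fun ha => ?_⟩
      exact h (a := Sum.inr PUnit.unit) ha
    · rintro ⟨h1, h2⟩ (x | x) hx
      · exact h1 hx
      · exact h2 hx

theorem flatRank_addColoopFlatIso [N.Finite] (A : N.FlatPoset) (b : Bool) :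
    (addColoop.{v, w} N).flatRank (N.addColoopFlatIso (A, b)) =
      N.flatRank A + if b then 1 else 0 := by
  have h := N.eRk_addColoop.{v, w} (X := (N.addColoopFlatIso (A, b)).1) A.2.subset_ground
  have h2 : (Sum.inr ⁻¹' (N.addColoopFlatIso.{v, w} (A, b)).1 : Set PUnit.{w + 1}) =
      {_x | b = true} := rfl
  rw [h2, ← coe_rkNat] at h
  change ((addColoop.{v, w} N).flatRank (N.addColoopFlatIso (A, b)) : ℕ∞) =
    N.eRk A.1 + _ at h
  rw [← coe_rkNat] at h
  change _ = (N.flatRank A : ℕ∞) + _ at h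
  cases b
  · simpa using h
  · have h1 : (Set.univ : Set PUnit.{w + 1}).encard = 1 := by simp
    simp only [Set.ofPred_true, h1] at h
    exact_mod_cast h

theorem addColoop_minFlat :
    N.addColoopFlatIso (N.minFlat, false) = (addColoop.{v, w} N).minFlat := by
  refine le_antisymm ?_ (minFlat_le _)
  rw [← N.addColoopFlatIso.apply_symm_apply (addColoop N).minFlat, OrderIso.le_iff_le]
  exact ⟨minFlat_le _, Bool.false_le _⟩

theorem addColoop_topFlat :
    N.addColoopFlatIso (N.topFlat, true) = (addColoop.{v, w} N).topFlat := by
  refine le_antisymm (le_topFlat _) ?_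
  rw [← N.addColoopFlatIso.apply_symm_apply (addColoop N).topFlat, OrderIso.le_iff_le]
  exact ⟨le_topFlat _, Bool.le_true _⟩

theorem loops_addColoop : N.loops = ∅ ↔ (addColoop.{v, w} N).loops = ∅ := by
  have h : (N.addColoopFlatIso.{v, w} (N.minFlat, false)).1 = (addColoop.{v, w} N).loops :=
    congrArg Subtype.val N.addColoop_minFlat
  rw [← h]
  change N.minFlat.1 = ∅ ↔ _
  constructor
  · intro h0
    ext (x | x)
    · change x ∈ N.minFlat.1 ↔ _
      simp [h0]
    · change false = true ↔ _
      simp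
  · intro h0
    ext x
    exact Set.ext_iff.1 h0 (Sum.inl x)

variable [N.Finite]

theorem klPolynomial_addColoop : (addColoop.{v, w} N).klPolynomial = N.klPolynomial := by
  by_cases h : N.loops = ∅
  · rw [klPolynomial_eq h, klPolynomial_eq (N.loops_addColoop.1 h), ← addColoop_minFlat,
      ← addColoop_topFlat]
    exact kl_prodBool N.addColoopFlatIso N.flatRank_mono
      (fun A => by simp [flatRank_addColoopFlatIso]) (fun A => by simp [flatRank_addColoopFlatIso])
      (minFlat_le _)
  · rw [klPolynomial_of_loops h, klPolynomial_of_loops (mt N.loops_addColoop.2 h)]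

theorem invKLPolynomial_addColoop :
    (addColoop.{v, w} N).invKLPolynomial = N.invKLPolynomial := by
  by_cases h : N.loops = ∅
  · rw [invKLPolynomial_eq h, invKLPolynomial_eq (N.loops_addColoop.1 h), ← addColoop_minFlat,
      ← addColoop_topFlat]
    exact invKL_prodBool N.addColoopFlatIso N.flatRank_mono
      (fun A => by simp [flatRank_addColoopFlatIso]) (fun A => by simp [flatRank_addColoopFlatIso])
      (minFlat_le _)
  · rw [invKLPolynomial_of_loops h, invKLPolynomial_of_loops (mt N.loops_addColoop.2 h)]

/-- Each flat yields two flats of adjacent ranks with the same P, contributing a factor 1 + t. -/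
theorem zPolynomial_addColoop :
    (addColoop.{v, w} N).zPolynomial = (1 + Polynomial.X) * N.zPolynomial := by
  classical
  let _ := Fintype.ofFinite N.FlatPoset
  let _ := Fintype.ofFinite (addColoop.{v, w} N).FlatPoset
  rw [zPolynomial_eq, zPolynomial_eq, ← N.addColoopFlatIso.toEquiv.sum_comp,
    Fintype.sum_prod_type, Finset.mul_sum]
  refine Finset.sum_congr rfl fun A _ => ?_
  rw [Fintype.sum_bool]
  have h0 : ∀ A, (addColoop.{v, w} N).flatRank (N.addColoopFlatIso (A, false)) = N.flatRank A :=
    fun A => by simp [flatRank_addColoopFlatIso]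
  have h1 : ∀ A, (addColoop.{v, w} N).flatRank (N.addColoopFlatIso (A, true)) =
    N.flatRank A + 1 := fun A => by simp [flatRank_addColoopFlatIso]
  simp only [RelIso.coe_fn_toEquiv, h0, h1]
  rw [← addColoop_topFlat, kl_prodBool N.addColoopFlatIso N.flatRank_mono h0 h1 (le_topFlat A),
    kl_prodBool_of_eq N.addColoopFlatIso h0 h1 true (le_topFlat A)]
  ring

end AddColoop

/-! ### Uniform matroids -/

section Uniform

theorem uniform_indep_iff {k n : ℕ} (I : Set (Fin n)) :
    (uniform k n).Indep I ↔ I.ncard ≤ k := by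
  simp [uniform]

theorem uniform_ground (k n : ℕ) : (uniform k n).E = Set.univ := by
  simp [uniform]

theorem IsBase.ncard_eq_rankNat {α : Type u} {M : Matroid α} {B : Set α} (hB : M.IsBase B) :
    B.ncard = M.rankNat := by
  rw [Set.ncard, hB.encard_eq_eRank, rankNat, rkNat, eRk_ground]

theorem rankNat_uniform {k n : ℕ} (hkn : k ≤ n) : (uniform k n).rankNat = k := by
  obtain ⟨B, hB⟩ := (uniform k n).exists_isBase
  rw [← hB.ncard_eq_rankNat, (uniform_isBase_iff hkn B).1 hB]

theorem ncard_sum {α : Type v} [Finite α] (X : Set (α ⊕ PUnit.{w + 1})) :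
    X.ncard = (Sum.inl ⁻¹' X : Set α).ncard + (Sum.inr ⁻¹' X : Set PUnit.{w + 1}).ncard := by
  have h := encard_sum X
  rw [← (Set.toFinite X).cast_ncard_eq, ← (Set.toFinite (Sum.inl ⁻¹' X)).cast_ncard_eq,
    ← (Set.toFinite (Sum.inr ⁻¹' X)).cast_ncard_eq] at h
  exact_mod_cast h

theorem rankNat_addColoop_uniform {k n : ℕ} (hkn : k ≤ n) :
    (addColoop.{0, w} (uniform k n)).rankNat = k + 1 := by
  have h := (uniform k n).flatRank_addColoopFlatIso.{0, w} (uniform k n).topFlat true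
  rw [addColoop_topFlat, flatRank_topFlat, flatRank_topFlat, rankNat_uniform hkn] at h
  simpa using h

/-- The sum has rank k + 1, and independence of a set avoiding the coloop means having at most k
elements. So (k + 1)-sets avoiding it are minimally dependent. -/
theorem isStressedHyperplane_addColoop_uniform {k n : ℕ} (hkn : k ≤ n) :
    (addColoop.{0, w} (uniform k n)).IsStressedHyperplane (Set.range Sum.inl) where
  isFlat := by
    rw [isFlat_addColoop_iff, Set.preimage_range, ← uniform_ground k n]
    exact ground_isFlat _
  rkNat_add_one := by
    rw [rankNat_addColoop_uniform hkn, rkNat, eRk_addColoop]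
    · rw [Set.preimage_range, ← uniform_ground k n, Set.preimage_inr_range_inl, Set.encard_empty,
        add_zero]
      exact congrArg (· + 1) (rankNat_uniform hkn)
    · rw [uniform_ground]
      exact Set.subset_univ _
  isCircuit S hS hc := by
    rw [rankNat_addColoop_uniform hkn] at hc
    have hr : ∀ T ⊆ S, (Sum.inr ⁻¹' T : Set PUnit.{w + 1}) = ∅ := by
      intro T hT
      ext x
      simp only [Set.mem_preimage, Set.mem_empty_iff_false, iff_false]
      intro hx
      obtain ⟨y, hy⟩ := hS (hT hx)
      exact Sum.inl_ne_inr hy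
    have hn : ∀ T ⊆ S, T.ncard = (Sum.inl ⁻¹' T : Set (Fin n)).ncard := by
      intro T hT
      rw [ncard_sum, hr T hT, Set.ncard_empty, add_zero]
    have hi : ∀ T, (addColoop.{0, w} (uniform k n)).Indep T ↔
        (Sum.inl ⁻¹' T : Set (Fin n)).ncard ≤ k := by
      intro T
      simp [addColoop, uniform_indep_iff]
    rw [isCircuit_iff_forall_ssubset, Dep, subset_ground_addColoop_iff, uniform_ground, hi,
      ← hn S subset_rfl]
    refine ⟨⟨by omega, Set.subset_univ _⟩, fun T hT => ?_⟩
    rw [hi, ← hn T hT.subset]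
    have := Set.ncard_lt_ncard hT (Set.toFinite S)
    omega

theorem isBase_relaxation_iff {α : Type u} {M : Matroid α} [M.Finite] {H : Set α}
    (hH : M.IsStressedHyperplane H) {B : Set α} :
    (M.relaxation hH).IsBase B ↔ M.IsBase B ∨ (B ⊆ H ∧ B.ncard = M.rankNat) := Iff.rfl

/-- The bases of the sum are the (k + 1)-sets containing the coloop, and relaxation adds those
avoiding it. -/
theorem relaxation_addColoop_uniform {k n : ℕ} (hkn : k ≤ n)
    (f : Fin n ⊕ PUnit.{w + 1} ≃ Fin (n + 1)) :
    ((addColoop.{0, w} (uniform k n)).relaxation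
      (isStressedHyperplane_addColoop_uniform hkn)).mapEquiv f = uniform (k + 1) (n + 1) := by
  refine ext_isBase ?_ fun B hB => ?_
  · rw [mapEquiv_ground_eq, uniform_ground]
    change f '' (addColoop.{0, w} (uniform k n)).E = _
    have : (addColoop.{0, w} (uniform k n)).E = Set.univ := by
      rw [Set.eq_univ_iff_forall]
      rintro (x | x) <;> simp [addColoop, uniform_ground]
    rw [this, Set.image_univ, f.surjective.range_eq]
  · rw [mapEquiv_isBase_iff, isBase_relaxation_iff, uniform_isBase_iff (by omega),
      rankNat_addColoop_uniform hkn, ← Set.ncard_image_of_injective B f.symm.injective]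
    generalize f.symm '' B = C
    rw [addColoop, sum_isBase_iff, uniform_isBase_iff hkn, freeOn_isBase_iff, ncard_sum]
    have hu : (Set.univ : Set PUnit.{w + 1}).ncard = 1 := by simp
    -- If the coloop is absent, `C` can only be a new basis; if it is present, only an old one.
    rcases Set.eq_empty_or_nonempty (Sum.inr ⁻¹' C : Set PUnit.{w + 1}) with h | ⟨⟨⟩, h⟩
    · have hsub : C ⊆ Set.range Sum.inl := by
        rintro (x | x) hx
        · exact ⟨x, rfl⟩
        · have : x ∈ (Sum.inr ⁻¹' C : Set PUnit.{w + 1}) := hx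
          simp [h] at this
      have he : (∅ : Set PUnit.{w + 1}) ≠ Set.univ := Set.empty_ne_univ
      simp [h, hsub, he]
    · have huniv : (Sum.inr ⁻¹' C : Set PUnit.{w + 1}) = Set.univ :=
        Set.eq_univ_iff_forall.2 fun _ => h
      have hsub : ¬ C ⊆ Set.range Sum.inl := fun hC => by
        obtain ⟨y, hy⟩ := hC h
        exact Sum.inl_ne_inr hy
      simp [huniv, hsub]

end Uniform

end Matroid

/-! ### Ranks, independence and flats -/

namespace Matroid

variable {α : Type u} {M : Matroid α}

theorem coe_ncard_eq_encard (M : Matroid α) [M.Finite] {A : Set α} (hA : A ⊆ M.E) :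
    (A.ncard : ℕ∞) = A.encard :=
  (M.ground_finite.subset hA).cast_ncard_eq

theorem Indep.rkNat_eq_ncard {I : Set α} (hI : M.Indep I) : M.rkNat I = I.ncard := by
  rw [rkNat, hI.eRk_eq_encard, Set.ncard]

theorem Indep.ncard_le_rkNat [M.Finite] {I A : Set α} (hI : M.Indep I) (hIA : I ⊆ A) :
    I.ncard ≤ M.rkNat A := by
  rw [← hI.rkNat_eq_ncard]
  exact M.rkNat_mono hIA

theorem rkNat_le_iff [M.Finite] {A : Set α} {n : ℕ} :
    M.rkNat A ≤ n ↔ ∀ I ⊆ A, M.Indep I → I.ncard ≤ n := by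
  rw [← ENat.natCast_le_natCast, coe_rkNat, eRk_le_iff]
  refine forall₃_congr fun I hI hi => ?_
  rw [← ENat.natCast_le_natCast, coe_ncard_eq_encard M hi.subset_ground]

/-- With flatness expressed through ranks, comparing the flats of a matroid and its relaxation
amounts to comparing rank functions. -/
theorem isFlat_iff_rkNat_lt [M.Finite] {F : Set α} :
    M.IsFlat F ↔ F ⊆ M.E ∧ ∀ x ∈ M.E \ F, M.rkNat F < M.rkNat (insert x F) := by
  constructor
  · refine fun h => ⟨h.subset_ground, fun x hx => ?_⟩
    have h1 := M.eRk_insert_eq_add_one (X := F) (e := x) (by rwa [h.closure])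
    rw [← coe_rkNat, ← coe_rkNat] at h1
    have h2 : M.rkNat (insert x F) = M.rkNat F + 1 := by exact_mod_cast h1
    omega
  · rintro ⟨hE, h⟩
    rw [isFlat_iff_closure_eq]
    refine Set.Subset.antisymm (fun x hx => ?_) (M.subset_closure F hE)
    by_contra hxF
    have h1 := h x ⟨M.closure_subset_ground F hx, hxF⟩
    have h2 : M.rkNat (insert x F) ≤ M.rkNat (M.closure F) :=
      M.rkNat_mono (Set.insert_subset hx (M.subset_closure F hE))
    have h3 : M.rkNat (M.closure F) = M.rkNat F := rkNat_eq_of_eRk_eq (M.eRk_closure_eq F)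
    omega

theorem flatRank_strictMono (M : Matroid α) [M.Finite] : StrictMono M.flatRank := by
  intro F G h
  obtain ⟨x, hxG, hxF⟩ := Set.exists_of_ssubset h
  exact ((isFlat_iff_rkNat_lt.1 F.2).2 x ⟨G.2.subset_ground hxG, hxF⟩).trans_le
    (M.rkNat_mono (Set.insert_subset hxG h.le))

theorem covBy_topFlat [M.Finite] {F : M.FlatPoset} (h : M.flatRank F + 1 = M.rankNat) :
    F ⋖ M.topFlat := by
  rw [← flatRank_topFlat] at h
  refine ⟨(le_topFlat F).lt_of_ne (fun he => ?_), fun G h1 h2 => ?_⟩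
  · rw [he] at h
    omega
  · have := M.flatRank_strictMono h1
    have := M.flatRank_strictMono h2
    omega

/-! ### The flats of the relaxation of a stressed hyperplane -/

namespace IsStressedHyperplane

variable {H : Set α} (hH : M.IsStressedHyperplane H)

include hH

theorem subset_ground : H ⊆ M.E := hH.isFlat.subset_ground

variable [M.Finite]

theorem rankNat_le_ncard_add_one : M.rankNat ≤ H.ncard + 1 := by
  rw [← hH.rkNat_add_one, Nat.add_le_add_iff_right, rkNat_le_iff]
  exact fun I hI _ => Set.ncard_le_ncard hI (M.ground_finite.subset hH.subset_ground)

/-- If H has at least k elements, the set lies properly inside a k-subset of H, which is a circuit.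
Otherwise H has exactly k - 1 elements, its rank, and is itself independent. -/
theorem indep_of_ncard_lt {A : Set α} (hA : A ⊆ H) (hc : A.ncard + 1 ≤ M.rankNat) :
    M.Indep A := by
  have hfin := M.ground_finite.subset hH.subset_ground
  by_cases hk : M.rankNat ≤ H.ncard
  · obtain ⟨S, hAS, hSH, hS⟩ := Set.exists_subsuperset_card_eq hA (by omega) hk
    refine (hH.isCircuit S hSH hS).ssubset_indep (hAS.ssubset_of_ne ?_)
    rintro rfl
    omega
  · have hr := hH.rkNat_add_one
    have hle := hH.rankNat_le_ncard_add_one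
    have hI : M.Indep H := by
      rw [indep_iff_eRk_eq_encard_of_finite hfin, ← coe_rkNat,
        ← coe_ncard_eq_encard M hH.subset_ground]
      exact_mod_cast (by omega : M.rkNat H = H.ncard)
    exact hI.subset hA

theorem insert_indep {A : Set α} (hA : A ⊆ H) (hc : A.ncard + 1 ≤ M.rankNat) {x : α}
    (hx : x ∈ M.E \ H) : M.Indep (insert x A) := by
  rw [(hH.indep_of_ncard_lt hA hc).insert_indep_iff]
  refine Or.inl ⟨hx.1, fun h => hx.2 ?_⟩
  exact hH.isFlat.closure ▸ M.closure_subset_closure hA h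

theorem exists_mem_diff : ∃ x, x ∈ M.E \ H := by
  by_contra! h
  have h1 : M.E ⊆ H := fun x hx => by_contra fun hxH => h x ⟨hx, hxH⟩
  have h2 := M.rkNat_mono h1
  have h3 := hH.rkNat_add_one
  rw [rankNat] at h3
  omega

/-- A subset of H with k - 1 or more elements already has the rank of H, so it is a flat only if it
equals H. A smaller one stays independent after adding any element. -/
theorem isFlat_iff_of_subset {F : Set α} (hF : F ⊆ H) :
    M.IsFlat F ↔ F.ncard + 1 < M.rankNat ∨ F = H := by
  have hfin : ∀ {A}, A ⊆ H → A.Finite := fun hA =>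
    M.ground_finite.subset (hA.trans hH.subset_ground)
  constructor
  · intro h
    by_contra! hcon
    obtain ⟨J, hJF, hJ⟩ := Set.exists_subset_card_eq (s := F) (n := M.rankNat - 1) (by omega)
    obtain ⟨x, hxH, hxF⟩ := Set.exists_of_ssubset (hF.ssubset_of_ne hcon.2)
    have h1 := (isFlat_iff_rkNat_lt.1 h).2 x ⟨hH.subset_ground hxH, hxF⟩
    have h2 := M.rkNat_mono (Set.insert_subset hxH hF)
    have h3 := hH.rkNat_add_one
    have h4 := (hH.indep_of_ncard_lt (hJF.trans hF) (by omega)).ncard_le_rkNat hJF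
    omega
  · rintro (h | rfl)
    · refine isFlat_iff_rkNat_lt.2 ⟨hF.trans hH.subset_ground, fun x hx => ?_⟩
      have hI : M.Indep (insert x F) := by
        by_cases hxH : x ∈ H
        · refine hH.indep_of_ncard_lt (Set.insert_subset hxH hF) ?_
          rw [Set.ncard_insert_of_notMem hx.2 (hfin hF)]
          omega
        · exact hH.insert_indep hF h.le ⟨hx.1, hxH⟩
      rw [hI.rkNat_eq_ncard, (hI.subset (Set.subset_insert x F)).rkNat_eq_ncard,
        Set.ncard_insert_of_notMem hx.2 (hfin hF)]
      omega
    · exact hH.isFlat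

theorem relaxation_indep_iff {I : Set α} :
    (M.relaxation hH).Indep I ↔ M.Indep I ∨ (I ⊆ H ∧ I.ncard = M.rankNat) := by
  rw [indep_iff]
  constructor
  · rintro ⟨B, hB, hIB⟩
    rcases (isBase_relaxation_iff hH).1 hB with hB | ⟨hBH, hB⟩
    · exact Or.inl (hB.indep.subset hIB)
    · by_cases h : I = B
      · exact Or.inr (h ▸ ⟨hBH, hB⟩)
      -- Proper subsets of a new basis have fewer than k elements and were independent already.
      · have := Set.ncard_lt_ncard (hIB.ssubset_of_ne h)
          (M.ground_finite.subset (hBH.trans hH.subset_ground))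
        exact Or.inl (hH.indep_of_ncard_lt (hIB.trans hBH) (by omega))
  · rintro (h | h)
    · obtain ⟨B, hB, hIB⟩ := h.exists_isBase_superset
      exact ⟨B, (isBase_relaxation_iff hH).2 (Or.inl hB), hIB⟩
    · exact ⟨I, (isBase_relaxation_iff hH).2 (Or.inr h), subset_rfl⟩

theorem relaxation_ground : (M.relaxation hH).E = M.E := rfl

theorem rankNat_relaxation : (M.relaxation hH).rankNat = M.rankNat := by
  obtain ⟨B, hB⟩ := M.exists_isBase
  rw [← ((isBase_relaxation_iff hH).2 (Or.inl hB)).ncard_eq_rankNat, hB.ncard_eq_rankNat]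

/-- Only new bases inside H could raise a rank. If the set also contains a point outside H,
exchanging one element of such a basis for that point gives an independent k-set of the original
matroid. -/
theorem rkNat_relaxation {A : Set α} (hAE : A ⊆ M.E) (hA : ¬ A ⊆ H) :
    (M.relaxation hH).rkNat A = M.rkNat A := by
  obtain ⟨x, hxA, hxH⟩ := Set.not_subset.1 hA
  refine le_antisymm (rkNat_le_iff.2 fun I hIA hI => ?_) (rkNat_le_iff.2 fun I hIA hI =>
    (hH.relaxation_indep_iff.2 (Or.inl hI)).ncard_le_rkNat hIA)
  rcases hH.relaxation_indep_iff.1 hI with hI | ⟨hIH, hI⟩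
  · exact hI.ncard_le_rkNat hIA
  · have hr := hH.rkNat_add_one
    obtain ⟨J, hJI, hJ⟩ := Set.exists_subset_card_eq (s := I) (n := M.rankNat - 1) (by omega)
    have hJH := hJI.trans hIH
    have h1 := (hH.insert_indep hJH (by omega) ⟨hAE hxA, hxH⟩).ncard_le_rkNat
      (Set.insert_subset hxA (hJI.trans hIA))
    rw [Set.ncard_insert_of_notMem (fun h => hxH (hJH h))
      (M.ground_finite.subset (hJH.trans hH.subset_ground))] at h1
    omega

theorem relaxation_isFlat_iff {F : Set α} (hF : ¬ F ⊆ H) :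
    (M.relaxation hH).IsFlat F ↔ M.IsFlat F := by
  rw [isFlat_iff_rkNat_lt, isFlat_iff_rkNat_lt, hH.relaxation_ground]
  refine and_congr_right fun hFE => forall₂_congr fun x hx => ?_
  rw [hH.rkNat_relaxation hFE hF, hH.rkNat_relaxation (Set.insert_subset hx.1 hFE)
    fun h => hF ((Set.subset_insert x F).trans h)]

/-- A subset of H with at least k elements now contains a basis, hence has full rank without being
the ground set. A smaller one stays independent after adding any element. -/
theorem relaxation_isFlat_iff_of_subset {F : Set α} (hF : F ⊆ H) :
    (M.relaxation hH).IsFlat F ↔ F.ncard + 1 ≤ M.rankNat := by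
  have hfin : F.Finite := M.ground_finite.subset (hF.trans hH.subset_ground)
  constructor
  · intro h
    by_contra! hcon
    obtain ⟨J, hJF, hJ⟩ := Set.exists_subset_card_eq (s := F) (n := M.rankNat) (by omega)
    obtain ⟨x, hx⟩ := hH.exists_mem_diff
    have h1 := (isFlat_iff_rkNat_lt.1 h).2 x ⟨hx.1, fun hxF => hx.2 (hF hxF)⟩
    have h2 := (M.relaxation hH).rkNat_mono
      (Set.insert_subset hx.1 (hF.trans hH.subset_ground) : insert x F ⊆ M.E)
    have h3 := (hH.relaxation_indep_iff.2 (Or.inr ⟨hJF.trans hF, hJ⟩)).ncard_le_rkNat hJF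
    have h4 : (M.relaxation hH).rkNat M.E = M.rankNat := hH.rankNat_relaxation
    omega
  · intro h
    refine isFlat_iff_rkNat_lt.2 ⟨hF.trans hH.subset_ground, fun x hx => ?_⟩
    have hI : (M.relaxation hH).Indep (insert x F) := by
      rw [hH.relaxation_indep_iff]
      by_cases hxH : x ∈ H
      · have hc := Set.ncard_insert_of_notMem hx.2 hfin
        by_cases hk : F.ncard + 1 = M.rankNat
        · exact Or.inr ⟨Set.insert_subset hxH hF, by omega⟩
        · exact Or.inl (hH.indep_of_ncard_lt (Set.insert_subset hxH hF) (by omega))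
      · exact Or.inl (hH.insert_indep hF h ⟨hx.1, hxH⟩)
    rw [hI.rkNat_eq_ncard, (hI.subset (Set.subset_insert x F)).rkNat_eq_ncard,
      Set.ncard_insert_of_notMem hx.2 hfin]
    omega

end IsStressedHyperplane

/-- `N` has the same flats and ranks as `M`, except that a hyperplane of `M` with `h` elements,
enumerated by `j`, is replaced by its subsets with `k - 1` elements. -/
structure IsRelaxationPair (M N : Matroid α) (k h : ℕ) (j : Fin h ↪ α) : Prop where
  ground_eq : N.E = M.E
  rankNat_left : M.rankNat = k
  rankNat_right : N.rankNat = k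
  not_ground_subset : ¬ M.E ⊆ Set.range j
  isFlat_left : ∀ A : Finset (Fin h), M.IsFlat (j '' A) ↔ A.card + 1 < k ∨ A = Finset.univ
  isFlat_right : ∀ A : Finset (Fin h), N.IsFlat (j '' A) ↔ A.card + 1 ≤ k
  isFlat_iff : ∀ F, ¬ F ⊆ Set.range j → (M.IsFlat F ↔ N.IsFlat F)
  rkNat_eq : ∀ F, M.IsFlat F → ¬ F ⊆ Set.range j → N.rkNat F = M.rkNat F
  rkNat_left : ∀ A : Finset (Fin h), A.card + 1 < k → M.rkNat (j '' A) = A.card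
  rkNat_hyperplane : M.rkNat (Set.range j) + 1 = k
  rkNat_right : ∀ A : Finset (Fin h), A.card + 1 ≤ k → N.rkNat (j '' A) = A.card

/-- The enumeration indexes the part of the lattice inside H by subsets of `Fin h`, a model shared
by all matroids with the same parameters. -/
theorem IsStressedHyperplane.isRelaxationPair [M.Finite] {h : ℕ} {j : Fin h ↪ α}
    (hH : M.IsStressedHyperplane (Set.range j)) :
    IsRelaxationPair M (M.relaxation hH) M.rankNat h j := by
  have hc : ∀ A : Finset (Fin h), (j '' (A : Set (Fin h))).ncard = A.card := fun A => by
    rw [Set.ncard_image_of_injective _ j.injective, Set.ncard_coe_finset]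
  have hs : ∀ A : Finset (Fin h), j '' (A : Set (Fin h)) ⊆ Set.range j := fun A =>
    Set.image_subset_range _ _
  refine ⟨rfl, rfl, hH.rankNat_relaxation, ?_, fun A => ?_, fun A => ?_,
    fun F hF => (hH.relaxation_isFlat_iff hF).symm,
    fun F h1 h2 => hH.rkNat_relaxation h1.subset_ground h2, fun A hA => ?_, hH.rkNat_add_one,
    fun A hA => ?_⟩
  · obtain ⟨x, hx⟩ := hH.exists_mem_diff
    exact fun h => hx.2 (h hx.1)
  · rw [hH.isFlat_iff_of_subset (hs A), hc, ← Set.image_univ, j.injective.image_injective.eq_iff,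
      Finset.coe_eq_univ]
  · rw [hH.relaxation_isFlat_iff_of_subset (hs A), hc]
  · rw [(hH.indep_of_ncard_lt (hs A) (by rw [hc]; omega)).rkNat_eq_ncard, hc]
  · rw [(hH.relaxation_indep_iff.2 (Or.inl (hH.indep_of_ncard_lt (hs A)
      (by rw [hc]; omega)))).rkNat_eq_ncard, hc]

end Matroid

/-! ### Sums over a finite poset with greatest element -/

namespace RankedPoset

open Finset

variable {S : Type*} [PartialOrder S] [LocallyFiniteOrder S]

theorem moebius_of_not_le {x y : S} (h : ¬ x ≤ y) : moebius x y = 0 := by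
  exact IncidenceAlgebra.apply_eq_zero_of_not_le h _

theorem charPoly_of_not_le (ρ : S → ℕ) {x y : S} (h : ¬ x ≤ y) : charPoly ρ x y = 0 := by
  rw [charPoly, Icc_eq_empty h, sum_empty]

/-- The Möbius function vanishes off the interval, so interval sums extend to the whole poset. In
this form sums over the two lattices can be subtracted term by term. -/
theorem sum_moebius_eq_zero [Fintype S] {x y : S} (hy : ∀ z, z ≤ y) (h : x ≠ y) :
    ∑ z, moebius x z = 0 := by
  classical
  have h1 := IncidenceAlgebra.sum_Icc_mu_right (𝕜 := ℤ) x y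
  rw [if_neg h] at h1
  rw [← h1]
  symm
  refine sum_subset_zero_on_sdiff (subset_univ _) (fun z hz => moebius_of_not_le ?_) fun z _ => ?_
  · simpa [hy z] using hz
  · rw [moebius]

theorem charPoly_eq_sum [Fintype S] (ρ : S → ℕ) (x : S) {y : S} (hy : ∀ z, z ≤ y) :
    charPoly ρ x y = ∑ z, Polynomial.C (moebius x z) * Polynomial.X ^ (ρ y - ρ z) := by
  classical
  refine sum_subset_zero_on_sdiff (subset_univ _) (fun z hz => ?_) fun z _ => rfl
  rw [moebius_of_not_le, map_zero, zero_mul]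
  simpa [hy z] using hz

end RankedPoset

namespace Matroid

open RankedPoset

theorem lowerHalf_sub (r : ℕ) (f g : ℤ[X]) :
    lowerHalf r (f - g) = lowerHalf r f - lowerHalf r g := by
  ext i
  simp only [coeff_lowerHalf, Polynomial.coeff_sub]
  split_ifs <;> simp

noncomputable instance flatPoset_fintype {α : Type u} (M : Matroid α) [M.Finite] :
    Fintype M.FlatPoset := Fintype.ofFinite _

/-! ### The part of the lattices of flats inside the hyperplane -/

/-- The sets with fewer than `k - 1` elements. -/
abbrev SmallSet (k h : ℕ) : Type := {A : Finset (Fin h) // A.card + 1 < k}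

/-- The sets with `k - 1` elements. -/
abbrev NewSet (k h : ℕ) : Type := {A : Finset (Fin h) // A.card + 1 = k}

/-- The flats inside a stressed hyperplane. -/
abbrev LowLeft (k h : ℕ) : Type := {A : Finset (Fin h) // A.card + 1 < k ∨ A = Finset.univ}

/-- The flats of the relaxation inside a stressed hyperplane. -/
abbrev LowRight (k h : ℕ) : Type := {A : Finset (Fin h) // A.card + 1 ≤ k}

section Low

variable {k h : ℕ}

noncomputable instance : LocallyFiniteOrder (LowLeft k h) :=
  LocallyFiniteOrder.ofFiniteIcc fun _ _ => Set.toFinite _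

noncomputable instance : LocallyFiniteOrder (LowRight k h) :=
  LocallyFiniteOrder.ofFiniteIcc fun _ _ => Set.toFinite _

/-- The rank function on the flats inside a stressed hyperplane. -/
def leftRank (A : LowLeft k h) : ℕ := if A.1.card + 1 < k then A.1.card else k - 1

/-- The rank function on the flats of the relaxation inside a stressed hyperplane. -/
def rightRank (A : LowRight k h) : ℕ := A.1.card

/-- A small set as a flat. -/
def SmallSet.left (A : SmallSet k h) : LowLeft k h := ⟨A.1, Or.inl A.2⟩

/-- A small set as a flat of the relaxation. -/
def SmallSet.right (A : SmallSet k h) : LowRight k h := ⟨A.1, A.2.le⟩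

/-- A set with `k - 1` elements as a flat of the relaxation. -/
def NewSet.right (A : NewSet k h) : LowRight k h := ⟨A.1, A.2.le⟩

/-- The hyperplane. -/
def LowLeft.top : LowLeft k h := ⟨Finset.univ, Or.inr rfl⟩

variable (k h) in
/-- The value at `A` of the change of the Möbius function under relaxation, up to sign. -/
noncomputable def relaxMoebius (A : SmallSet k h) : ℤ :=
  ∑ B : NewSet k h, moebius A.right B.right - moebius A.left LowLeft.top

open Classical in
/-- The recursion for the change of the Kazhdan–Lusztig polynomials under relaxation. -/
noncomputable def relaxKLStep (D : SmallSet k h → ℤ[X]) (A : SmallSet k h) : ℤ[X] :=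
  -lowerHalf (k - A.1.card) ((Polynomial.X - 1) * Polynomial.C (relaxMoebius k h A) +
    ∑ B : SmallSet k h, (if A < B then charPoly rightRank A.right B.right * D B else 0) +
    ∑ B : NewSet k h, charPoly rightRank A.right B.right -
    charPoly leftRank A.left LowLeft.top)

/-- The step at A uses D only at strictly larger small sets, so its fixed point is unique by
induction on k - |A|. -/
theorem eq_of_relaxKLStep {D D' : SmallSet k h → ℤ[X]} (hD : ∀ A, D A = relaxKLStep D A)
    (hD' : ∀ A, D' A = relaxKLStep D' A) (A : SmallSet k h) : D A = D' A := by
  induction hn : k - A.1.card using Nat.strong_induction_on generalizing A with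
  | _ n ih =>
  rw [hD, hD', relaxKLStep, relaxKLStep]
  have hs : ∀ B : SmallSet k h, A < B → D B = D' B := by
    intro B hAB
    have h1 : A.1.card < B.1.card := Finset.card_lt_card hAB
    have h2 := B.2
    exact ih _ (by omega) B rfl
  congr 5
  refine Finset.sum_congr rfl fun B _ => ?_
  split_ifs with hAB
  · rw [hs B hAB]
  · rfl

end Low

/-- The flats not inside the range of `j`. -/
abbrev OffFlat {α : Type u} (M : Matroid α) {h : ℕ} (j : Fin h ↪ α) : Type u :=
  {F : Set α // M.IsFlat F ∧ ¬ F ⊆ Set.range j}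

/-- The common proper flats of two matroids. -/
abbrev CommonFlat {α : Type u} (M N : Matroid α) : Type u :=
  {F : Set α // M.IsFlat F ∧ N.IsFlat F ∧ F ≠ M.E}

instance {α : Type u} (M : Matroid α) [M.Finite] {h : ℕ} (j : Fin h ↪ α) :
    Finite (OffFlat M j) :=
  Finite.of_injective (fun F : OffFlat M j => (⟨F.1, F.2.1⟩ : M.FlatPoset))
    fun _ _ h => Subtype.ext (by simpa using h)

instance {α : Type u} (M N : Matroid α) [M.Finite] : Finite (CommonFlat M N) :=
  Finite.of_injective (fun F : CommonFlat M N => (⟨F.1, F.2.1⟩ : M.FlatPoset))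
    fun _ _ h => Subtype.ext (by simpa using h)

noncomputable instance {α : Type u} (M : Matroid α) [M.Finite] {h : ℕ} (j : Fin h ↪ α) :
    Fintype (OffFlat M j) := Fintype.ofFinite _

noncomputable instance {α : Type u} (M : Matroid α) [M.Finite] {h : ℕ} (j : Fin h ↪ α) :
    LocallyFiniteOrder (OffFlat M j) :=
  LocallyFiniteOrder.ofFiniteIcc fun _ _ => Set.toFinite _

noncomputable instance {α : Type u} (M N : Matroid α) [M.Finite] :
    LocallyFiniteOrder (CommonFlat M N) :=
  LocallyFiniteOrder.ofFiniteIcc fun _ _ => Set.toFinite _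

/-- The flats of `M` not inside the hyperplane. -/
def offLeft {α : Type u} (M : Matroid α) {h : ℕ} (j : Fin h ↪ α) : OffFlat M j ↪o M.FlatPoset :=
  OrderEmbedding.ofMapLEIff (fun F => ⟨F.1, F.2.1⟩) fun _ _ => Iff.rfl

/-- The common proper flats, as flats of `M`. -/
def commonLeft {α : Type u} (M N : Matroid α) : CommonFlat M N ↪o M.FlatPoset :=
  OrderEmbedding.ofMapLEIff (fun F => ⟨F.1, F.2.1⟩) fun _ _ => Iff.rfl

/-- The common proper flats, as flats of `N`. -/
def commonRight {α : Type u} (M N : Matroid α) : CommonFlat M N ↪o N.FlatPoset :=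
  OrderEmbedding.ofMapLEIff (fun F => ⟨F.1, F.2.2.1⟩) fun _ _ => Iff.rfl

theorem IsFlat.inter {α : Type u} {M : Matroid α} {F G : Set α} (hF : M.IsFlat F)
    (hG : M.IsFlat G) : M.IsFlat (F ∩ G) := by
  rw [isFlat_iff_closure_eq]
  refine Set.Subset.antisymm (Set.subset_inter ?_ ?_)
    (M.subset_closure _ (Set.inter_subset_left.trans hF.subset_ground))
  · exact (M.closure_subset_closure Set.inter_subset_left).trans hF.closure.subset
  · exact (M.closure_subset_closure Set.inter_subset_right).trans hG.closure.subset

theorem exists_finset_image_eq {α : Type u} {h : ℕ} (j : Fin h ↪ α) {F : Set α}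
    (hF : F ⊆ Set.range j) : ∃ A : Finset (Fin h), j '' A = F := by
  obtain ⟨B, rfl⟩ := Set.subset_range_iff_exists_image_eq.1 hF
  exact ⟨(Set.toFinite B).toFinset, by simp⟩

theorem offLeft_ordConnected {α : Type u} (M : Matroid α) {h : ℕ} (j : Fin h ↪ α) : (Set.range (offLeft M j)).OrdConnected := by
  refine ⟨?_⟩
  rintro _ ⟨A, rfl⟩ _ - t ht
  exact ⟨⟨t.1, t.2, fun h => A.2.2 (Set.Subset.trans ht.1 h)⟩, rfl⟩

/-! ### Common parts of the lattices of flats of a relaxation pair -/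

namespace IsRelaxationPair

set_option linter.unusedSectionVars false

variable {α : Type u} {M N : Matroid α} {k h : ℕ} {j : Fin h ↪ α}
  (hp : IsRelaxationPair M N k h j)

theorem image_subset_image_iff {A B : Finset (Fin h)} : j '' A ⊆ j '' B ↔ A ⊆ B := by
  rw [Set.image_subset_image_iff j.injective, Finset.coe_subset]

include hp

theorem le_add_one : k ≤ h + 1 := by
  by_contra! hlt
  have h1 := hp.rkNat_left Finset.univ (by simpa using hlt)
  have h2 := hp.rkNat_hyperplane
  rw [Finset.coe_univ, Set.image_univ] at h1
  simp only [Finset.card_univ, Fintype.card_fin] at h1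
  omega

/-- The flats of `M` inside the hyperplane. -/
def leftEmb : LowLeft k h ↪o M.FlatPoset :=
  OrderEmbedding.ofMapLEIff (fun A => ⟨j '' A.1, (hp.isFlat_left A.1).2 A.2⟩)
    fun _ _ => image_subset_image_iff

/-- The flats of `N` inside the hyperplane. -/
def rightEmb : LowRight k h ↪o N.FlatPoset :=
  OrderEmbedding.ofMapLEIff (fun A => ⟨j '' A.1, (hp.isFlat_right A.1).2 A.2⟩)
    fun _ _ => image_subset_image_iff

/-- The flats of `N` not inside the hyperplane. -/
def offRight : OffFlat M j ↪o N.FlatPoset :=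
  OrderEmbedding.ofMapLEIff (fun F => ⟨F.1, (hp.isFlat_iff F.1 F.2.2).1 F.2.1⟩)
    fun _ _ => Iff.rfl

theorem leftEmb_ordConnected : (Set.range hp.leftEmb).OrdConnected := by
  refine ⟨?_⟩
  rintro _ - _ ⟨B, rfl⟩ t ht
  obtain ⟨A, hA⟩ := exists_finset_image_eq j
    (Set.Subset.trans ht.2 (Set.image_subset_range j B.1))
  exact ⟨⟨A, (hp.isFlat_left A).1 (hA ▸ t.2)⟩, Subtype.ext hA⟩

theorem rightEmb_ordConnected : (Set.range hp.rightEmb).OrdConnected := by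
  refine ⟨?_⟩
  rintro _ - _ ⟨B, rfl⟩ t ht
  obtain ⟨A, hA⟩ := exists_finset_image_eq j
    (Set.Subset.trans ht.2 (Set.image_subset_range j B.1))
  exact ⟨⟨A, (hp.isFlat_right A).1 (hA ▸ t.2)⟩, Subtype.ext hA⟩

theorem offRight_ordConnected : (Set.range hp.offRight).OrdConnected := by
  refine ⟨?_⟩
  rintro _ ⟨A, rfl⟩ _ - t ht
  have h : ¬ t.1 ⊆ Set.range j := fun h => A.2.2 (Set.Subset.trans ht.1 h)
  exact ⟨⟨t.1, (hp.isFlat_iff t.1 h).2 t.2, h⟩, rfl⟩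

theorem isFlat_range : M.IsFlat (Set.range j) := by
  have := (hp.isFlat_left Finset.univ).2 (Or.inr rfl)
  rwa [Finset.coe_univ, Set.image_univ] at this

theorem flatRank_leftEmb (A : LowLeft k h) : M.flatRank (hp.leftEmb A) = leftRank A := by
  rw [leftRank]
  split_ifs with hA
  · exact hp.rkNat_left A.1 hA
  · have h1 : A.1 = Finset.univ := A.2.resolve_left hA
    have h2 := hp.rkNat_hyperplane
    change M.rkNat (j '' A.1) = _
    rw [h1, Finset.coe_univ, Set.image_univ]
    omega

theorem flatRank_rightEmb (A : LowRight k h) : N.flatRank (hp.rightEmb A) = rightRank A :=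
  hp.rkNat_right A.1 A.2

theorem rkNat_common (F : CommonFlat M N) : N.rkNat F.1 = M.rkNat F.1 := by
  by_cases hr : F.1 ⊆ Set.range j
  · obtain ⟨A, hA⟩ := exists_finset_image_eq j hr
    have h1 := (hp.isFlat_right A).1 (hA ▸ F.2.2.1)
    have h2 := (hp.isFlat_left A).1 (hA ▸ F.2.1)
    rw [← hA, hp.rkNat_right A h1]
    by_cases h3 : A.card + 1 < k
    · rw [hp.rkNat_left A h3]
    -- This is the degenerate case |H| = k - 1, where H is a flat of both matroids.
    · have h4 := h2.resolve_left h3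
      have h5 := hp.rkNat_hyperplane
      rw [← Set.image_univ, ← Finset.coe_univ, ← h4] at h5
      omega
  · exact hp.rkNat_eq _ F.2.1 hr

variable [M.Finite]

theorem not_between {F : Set α} (hF : M.IsFlat F) (hr : Set.range j ⊆ F)
    (hn : ¬ F ⊆ Set.range j) : F = M.E := by
  have hc : (⟨Set.range j, hp.isFlat_range⟩ : M.FlatPoset) ⋖ M.topFlat :=
    covBy_topFlat (hp.rkNat_hyperplane.trans hp.rankNat_left.symm)
  by_contra hE
  exact hc.2 (c := ⟨F, hF⟩) ⟨hr, hn⟩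
    ((le_topFlat _).lt_of_ne fun h => hE (congrArg Subtype.val h))

/-- The common proper flats form a lower set: only H could fail to be a flat of `N`, and the only
proper flat of `M` containing H is H. The ground set is left out because in general not every flat
below it is common. -/
theorem commonLeft_ordConnected : (Set.range (commonLeft M N)).OrdConnected := by
  refine ⟨?_⟩
  rintro _ - _ ⟨F, rfl⟩ t ht
  have htF : t.1 ⊆ F.1 := ht.2
  have hE : t.1 ≠ M.E := fun h =>
    F.2.2.2 (Set.Subset.antisymm F.2.1.subset_ground (h.symm.subset.trans htF))
  refine ⟨⟨t.1, t.2, ?_, hE⟩, rfl⟩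
  by_cases hr : t.1 ⊆ Set.range j
  · obtain ⟨A, hA⟩ := exists_finset_image_eq j hr
    rcases (hp.isFlat_left A).1 (hA ▸ t.2) with h1 | h1
    · rw [← hA]
      exact (hp.isFlat_right A).2 h1.le
    · rw [h1, Finset.coe_univ, Set.image_univ] at hA
      have hF : F.1 ⊆ Set.range j := by
        by_contra hF
        exact F.2.2.2 (hp.not_between F.2.1 (hA.subset.trans htF) hF)
      rw [Set.Subset.antisymm htF (hF.trans hA.subset)]
      exact F.2.2.1
  · exact (hp.isFlat_iff _ hr).1 t.2

/-- Again a lower set. A flat of `N` inside H and below a common flat F lies in F ∩ H, a flat of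
`M`. Either F ∩ H is small, or F = H and H has at most k - 1 elements. -/
theorem commonRight_ordConnected : (Set.range (commonRight M N)).OrdConnected := by
  refine ⟨?_⟩
  rintro _ - _ ⟨F, rfl⟩ t ht
  have htF : t.1 ⊆ F.1 := ht.2
  have hE : t.1 ≠ M.E := fun h =>
    F.2.2.2 (Set.Subset.antisymm F.2.1.subset_ground (h.symm.subset.trans htF))
  refine ⟨⟨t.1, ?_, t.2, hE⟩, rfl⟩
  by_cases hr : t.1 ⊆ Set.range j
  · obtain ⟨A, hA⟩ := exists_finset_image_eq j hr
    have hAk := (hp.isFlat_right A).1 (hA ▸ t.2)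
    obtain ⟨B, hB⟩ := exists_finset_image_eq j (Set.inter_subset_right (s := F.1) (t := Set.range j))
    have hAB : A ⊆ B := by
      rw [← image_subset_image_iff (j := j), hA, hB]
      exact Set.subset_inter htF hr
    have hBF : M.IsFlat (j '' B) := by
      rw [hB]
      exact F.2.1.inter hp.isFlat_range
    have hcard := Finset.card_le_card hAB
    rw [← hA, hp.isFlat_left]
    rcases (hp.isFlat_left B).1 hBF with h1 | h1
    · exact Or.inl (by omega)
    · rw [h1, Finset.coe_univ, Set.image_univ] at hB
      have hrF : Set.range j ⊆ F.1 := hB.subset.trans Set.inter_subset_left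
      have hF : F.1 ⊆ Set.range j := by
        by_contra hF
        exact F.2.2.2 (hp.not_between F.2.1 hrF hF)
      have hN := F.2.2.1
      rw [Set.Subset.antisymm hF hrF, ← Set.image_univ, ← Finset.coe_univ, hp.isFlat_right,
        Finset.card_univ, Fintype.card_fin] at hN
      by_cases hlt : A.card + 1 < k
      · exact Or.inl hlt
      · refine Or.inr ((Finset.card_eq_iff_eq_univ A).1 ?_)
        have := A.card_le_univ
        rw [Fintype.card_fin] at this ⊢
        omega
  · exact (hp.isFlat_iff _ hr).2 t.2

variable [N.Finite]

theorem rank_commonRight (F G : CommonFlat M N) (_ : F ≤ G) :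
    N.flatRank (commonRight M N G) - N.flatRank (commonRight M N F) =
      M.rkNat G.1 - M.rkNat F.1 := by
  rw [← hp.rkNat_common, ← hp.rkNat_common]
  rfl

theorem moebius_common (F G : CommonFlat M N) :
    moebius (commonRight M N F) (commonRight M N G) =
      moebius (commonLeft M N F) (commonLeft M N G) := by
  rw [moebius_map _ hp.commonRight_ordConnected, moebius_map _ hp.commonLeft_ordConnected]

theorem charPoly_common (F G : CommonFlat M N) :
    charPoly N.flatRank (commonRight M N F) (commonRight M N G) =
      charPoly M.flatRank (commonLeft M N F) (commonLeft M N G) := by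
  rw [charPoly_map (ρ := fun F : CommonFlat M N => M.rkNat F.1) _ hp.commonRight_ordConnected
    hp.rank_commonRight, charPoly_map (ρ := fun F : CommonFlat M N => M.rkNat F.1) _
    hp.commonLeft_ordConnected (fun _ _ _ => rfl)]

theorem invKL_common {F G : CommonFlat M N} (hFG : F ≤ G) :
    invKL N.flatRank (commonRight M N F) (commonRight M N G) =
      invKL M.flatRank (commonLeft M N F) (commonLeft M N G) := by
  rw [invKL_map (ρ := fun F : CommonFlat M N => M.rkNat F.1) _ hp.commonRight_ordConnected
    hp.rank_commonRight hFG, invKL_map (ρ := fun F : CommonFlat M N => M.rkNat F.1) _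
    hp.commonLeft_ordConnected (fun _ _ _ => rfl) hFG]

theorem rank_offRight (F : OffFlat M j) : N.flatRank (hp.offRight F) = M.flatRank (offLeft M j F) :=
  hp.rkNat_eq F.1 F.2.1 F.2.2

/-- The flats not inside H form an upper set in both lattices, so the intervals above them agree, up
to and including the ground set. -/
theorem charPoly_off (F G : OffFlat M j) :
    charPoly N.flatRank (hp.offRight F) (hp.offRight G) =
      charPoly M.flatRank (offLeft M j F) (offLeft M j G) := by
  rw [charPoly_map (ρ := fun F => M.flatRank (offLeft M j F)) _ hp.offRight_ordConnected
    fun F G _ => by rw [rank_offRight, rank_offRight],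
    charPoly_map (ρ := fun F => M.flatRank (offLeft M j F)) _ (offLeft_ordConnected M j)
    fun F G _ => rfl]

theorem kl_off {F G : OffFlat M j} (hFG : F ≤ G) :
    kl N.flatRank (hp.offRight F) (hp.offRight G) =
      kl M.flatRank (offLeft M j F) (offLeft M j G) := by
  rw [kl_map (ρ := fun F => M.flatRank (offLeft M j F)) _ hp.offRight_ordConnected
    (fun F G _ => by rw [rank_offRight, rank_offRight]) hFG,
    kl_map (ρ := fun F => M.flatRank (offLeft M j F)) _ (offLeft_ordConnected M j)
    (fun F G _ => rfl) hFG]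

theorem charPoly_leftEmb (A B : LowLeft k h) :
    charPoly M.flatRank (hp.leftEmb A) (hp.leftEmb B) = charPoly leftRank A B :=
  charPoly_map _ hp.leftEmb_ordConnected
    (fun A B _ => by rw [flatRank_leftEmb, flatRank_leftEmb]) A B

theorem charPoly_rightEmb (A B : LowRight k h) :
    charPoly N.flatRank (hp.rightEmb A) (hp.rightEmb B) = charPoly rightRank A B :=
  charPoly_map _ hp.rightEmb_ordConnected
    (fun A B _ => by rw [flatRank_rightEmb, flatRank_rightEmb]) A B

theorem invKL_leftEmb {A B : LowLeft k h} (hAB : A ≤ B) :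
    invKL M.flatRank (hp.leftEmb A) (hp.leftEmb B) = invKL leftRank A B :=
  invKL_map _ hp.leftEmb_ordConnected
    (fun A B _ => by rw [flatRank_leftEmb, flatRank_leftEmb]) hAB

theorem invKL_rightEmb {A B : LowRight k h} (hAB : A ≤ B) :
    invKL N.flatRank (hp.rightEmb A) (hp.rightEmb B) = invKL rightRank A B :=
  invKL_map _ hp.rightEmb_ordConnected
    (fun A B _ => by rw [flatRank_rightEmb, flatRank_rightEmb]) hAB

/-- The ground set, as a flat not inside the hyperplane. -/
def offTop : OffFlat M j := ⟨M.E, M.ground_isFlat, hp.not_ground_subset⟩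

theorem offRight_offTop : hp.offRight hp.offTop = N.topFlat := Subtype.ext hp.ground_eq.symm

/-- A small set as a common flat. -/
def small (A : SmallSet k h) : CommonFlat M N :=
  ⟨j '' A.1, (hp.isFlat_left A.1).2 (Or.inl A.2), (hp.isFlat_right A.1).2 A.2.le,
    fun hE => hp.not_ground_subset (hE ▸ Set.image_subset_range _ _)⟩

/-- A proper flat not inside the hyperplane as a common flat. -/
def off {F : OffFlat M j} (hF : F ≠ hp.offTop) : CommonFlat M N :=
  ⟨F.1, F.2.1, (hp.isFlat_iff F.1 F.2.2).1 F.2.1, fun hE => hF (Subtype.ext hE)⟩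

/-- The two kinds of flats are disjoint because k ≤ h + 1 prevents H from being small. -/
theorem sum_low {R : Type*} [AddCommGroup R] (g : LowLeft k h → R) :
    ∑ A, g A = ∑ A : SmallSet k h, g A.left + g LowLeft.top := by
  have hb : Function.Bijective
      (Sum.elim SmallSet.left (fun _ => LowLeft.top) : SmallSet k h ⊕ Unit → LowLeft k h) := by
    have hk := hp.le_add_one
    constructor
    · rintro (A | A) (B | B) hAB
      · have h1 : A.1 = B.1 := congrArg (fun X : LowLeft k h => X.1) hAB
        exact congrArg Sum.inl (Subtype.ext h1)
      · have h1 : A.1 = Finset.univ := Subtype.ext_iff.1 hAB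
        have h2 := A.2
        rw [h1, Finset.card_univ, Fintype.card_fin] at h2
        omega
      · have h1 : Finset.univ = B.1 := Subtype.ext_iff.1 hAB
        have h2 := B.2
        rw [← h1, Finset.card_univ, Fintype.card_fin] at h2
        omega
      · rfl
    · rintro ⟨A, hA | hA⟩
      · exact ⟨Sum.inl ⟨A, hA⟩, rfl⟩
      · exact ⟨Sum.inr (), Subtype.ext hA.symm⟩
  rw [← hb.sum_comp, Fintype.sum_sum_type]
  simp

omit hp [M.Finite] [N.Finite] in
theorem sum_lowRight {R : Type*} [AddCommGroup R] (g : LowRight k h → R) :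
    ∑ A, g A = ∑ A : SmallSet k h, g A.right + ∑ B : NewSet k h, g B.right := by
  have hb : Function.Bijective
      (Sum.elim SmallSet.right NewSet.right : SmallSet k h ⊕ NewSet k h → LowRight k h) := by
    constructor
    · rintro (A | A) (B | B) hAB
      · have h1 : A.1 = B.1 := congrArg (fun X : LowRight k h => X.1) hAB
        exact congrArg Sum.inl (Subtype.ext h1)
      · have h1 : A.1 = B.1 := Subtype.ext_iff.1 hAB
        have h2 := A.2
        have h3 := B.2
        rw [h1] at h2
        omega
      · have h1 : A.1 = B.1 := Subtype.ext_iff.1 hAB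
        have h2 := A.2
        have h3 := B.2
        rw [h1] at h2
        omega
      · have h1 : A.1 = B.1 := congrArg (fun X : LowRight k h => X.1) hAB
        exact congrArg Sum.inr (Subtype.ext h1)
    · rintro ⟨A, hA⟩
      rcases hA.lt_or_eq with h | h
      · exact ⟨Sum.inl ⟨A, h⟩, rfl⟩
      · exact ⟨Sum.inr ⟨A, h⟩, rfl⟩
  rw [← hb.sum_comp, Fintype.sum_sum_type]
  simp

theorem sum_left {R : Type*} [AddCommGroup R] (g : M.FlatPoset → R) :
    ∑ F, g F = ∑ F, g (offLeft M j F) + ∑ A, g (hp.leftEmb A) := by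
  have hb : Function.Bijective
      (Sum.elim (offLeft M j) hp.leftEmb : OffFlat M j ⊕ LowLeft k h → M.FlatPoset) := by
    constructor
    · refine (offLeft M j).injective.sumElim hp.leftEmb.injective fun F A hFA => ?_
      have h1 : F.1 = j '' A.1 := Subtype.ext_iff.1 hFA
      exact F.2.2 (h1 ▸ Set.image_subset_range _ _)
    · intro F
      by_cases hF : F.1 ⊆ Set.range j
      · obtain ⟨A, hA⟩ := exists_finset_image_eq j hF
        exact ⟨Sum.inr ⟨A, (hp.isFlat_left A).1 (hA ▸ F.2)⟩, Subtype.ext hA⟩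
      · exact ⟨Sum.inl ⟨F.1, F.2, hF⟩, rfl⟩
  rw [← hb.sum_comp, Fintype.sum_sum_type]
  simp

theorem sum_right {R : Type*} [AddCommGroup R] (g : N.FlatPoset → R) :
    ∑ F, g F = ∑ F, g (hp.offRight F) + ∑ A, g (hp.rightEmb A) := by
  have hb : Function.Bijective
      (Sum.elim hp.offRight hp.rightEmb : OffFlat M j ⊕ LowRight k h → N.FlatPoset) := by
    constructor
    · refine hp.offRight.injective.sumElim hp.rightEmb.injective fun F A hFA => ?_
      have h1 : F.1 = j '' A.1 := Subtype.ext_iff.1 hFA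
      exact F.2.2 (h1 ▸ Set.image_subset_range _ _)
    · intro F
      by_cases hF : F.1 ⊆ Set.range j
      · obtain ⟨A, hA⟩ := exists_finset_image_eq j hF
        exact ⟨Sum.inr ⟨A, (hp.isFlat_right A).1 (hA ▸ F.2)⟩, Subtype.ext hA⟩
      · exact ⟨Sum.inl ⟨F.1, (hp.isFlat_iff F.1 hF).2 F.2, hF⟩, rfl⟩
  rw [← hb.sum_comp, Fintype.sum_sum_type]
  simp

/-- This is the cancellation behind all later comparisons. It isolates the terms that relaxation can
change. -/
theorem sum_sub_sum {R : Type*} [AddCommGroup R] (g : M.FlatPoset → R) (g' : N.FlatPoset → R)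
    (hoff : ∀ F : OffFlat M j, F ≠ hp.offTop → g' (hp.offRight F) = g (offLeft M j F)) :
    ∑ F, g' F - ∑ F, g F = (g' N.topFlat - g M.topFlat) +
      ∑ A : SmallSet k h, (g' (hp.rightEmb A.right) - g (hp.leftEmb A.left)) +
      ∑ B : NewSet k h, g' (hp.rightEmb B.right) - g (hp.leftEmb LowLeft.top) := by
  have h1 : ∑ F, g' (hp.offRight F) - ∑ F, g (offLeft M j F) = g' N.topFlat - g M.topFlat := by
    rw [← Finset.sum_sub_distrib, Fintype.sum_eq_single hp.offTop
      fun F hF => by rw [hoff F hF, sub_self], offRight_offTop]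
    rfl
  rw [hp.sum_left, hp.sum_right, hp.sum_low, sum_lowRight, Finset.sum_sub_distrib, ← h1]
  abel

end IsRelaxationPair

end Matroid

namespace Matroid

open RankedPoset

/-! ### The change of the invariants under relaxation -/

section LowOrder

variable {k h : ℕ}

theorem SmallSet.lt_new_iff {A : SmallSet k h} {B : NewSet k h} :
    A.right < B.right ↔ A.right ≤ B.right := by
  refine ⟨le_of_lt, fun hle => hle.lt_of_ne fun hAB => ?_⟩
  have h1 : A.1 = B.1 := congrArg (fun X : LowRight k h => X.1) hAB
  have h2 := A.2
  have h3 := B.2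
  rw [h1] at h2
  omega

theorem SmallSet.lt_top (hk : k ≤ h + 1) (A : SmallSet k h) : A.left < LowLeft.top := by
  refine lt_of_le_of_ne (Finset.subset_univ A.1) fun hAB => ?_
  have h1 : A.1 = Finset.univ := congrArg (fun X : LowLeft k h => X.1) hAB
  have h2 := A.2
  rw [h1, Finset.card_univ, Fintype.card_fin] at h2
  omega

/-- The empty set as a small set. -/
def SmallSet.empty (hk : 2 ≤ k) : SmallSet k h := ⟨∅, by rw [Finset.card_empty]; omega⟩

variable (h) in
/-- The change of the inverse Kazhdan–Lusztig polynomial under relaxation. -/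
noncomputable def relaxInvKL (hk : 2 ≤ k) : ℤ[X] :=
  -(-1) ^ k * lowerHalf k (∑ B : SmallSet k h,
      (-1) ^ B.1.card * invKL rightRank (SmallSet.empty hk).right B.right *
        ((Polynomial.X - 1) * Polynomial.C (relaxMoebius k h B)).reflect (k - B.1.card) +
    ∑ B : NewSet k h, (-1) ^ (k - 1) * invKL rightRank (SmallSet.empty hk).right B.right *
        (1 - Polynomial.X) -
    (-1) ^ (k - 1) * invKL leftRank (SmallSet.empty (h := h) hk).left LowLeft.top *
        (1 - Polynomial.X))

end LowOrder

/-- The recursion is rewritten as a sum over all flats, with the range as an indicator, so that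
`sum_sub_sum` applies. -/
theorem invKL_top_eq {α : Type u} {M : Matroid α} [M.Finite] [DecidableLT M.FlatPoset]
    (hM : M.minFlat ≠ M.topFlat) :
    invKL M.flatRank M.minFlat M.topFlat = -(-1) ^ M.rankNat * lowerHalf M.rankNat
      (∑ G, if G < M.topFlat then (-1) ^ M.flatRank G * invKL M.flatRank M.minFlat G *
        (charPoly M.flatRank G M.topFlat).reflect (M.rankNat - M.flatRank G) else 0) := by
  rw [invKL_of_ne _ hM, ← Finset.sum_filter, flatRank_minFlat, Nat.sub_zero]
  have : Finset.Ico M.minFlat M.topFlat = Finset.univ.filter (· < M.topFlat) := by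
    ext G
    simp [minFlat_le]
  rw [this]
  rfl

theorem kl_top_eq {α : Type u} {M : Matroid α} [M.Finite] [DecidableLT M.FlatPoset]
    {F : M.FlatPoset} (hF : F < M.topFlat) :
    kl M.flatRank F M.topFlat = -lowerHalf (M.rankNat - M.flatRank F)
      (∑ G, if F < G then charPoly M.flatRank F G * kl M.flatRank G M.topFlat else 0) := by
  rw [kl_of_ne _ hF.ne, ← Finset.sum_filter]
  have : Finset.Ioc F M.topFlat = Finset.univ.filter (F < ·) := by
    ext G
    simp [le_topFlat]
  rw [this]
  rfl

namespace IsRelaxationPair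

set_option linter.unusedSectionVars false

variable {α : Type u} {M N : Matroid α} {k h : ℕ} {j : Fin h ↪ α}
  (hp : IsRelaxationPair M N k h j) [M.Finite] [N.Finite]

include hp

theorem lt_topFlat_left (A : SmallSet k h) : hp.leftEmb A.left < M.topFlat :=
  (le_topFlat _).lt_of_ne fun hA => (hp.small A).2.2.2 (congrArg Subtype.val hA)

theorem lt_topFlat_right (A : LowRight k h) : hp.rightEmb A < N.topFlat :=
  (le_topFlat _).lt_of_ne fun hA => hp.not_ground_subset (by
    have h1 : j '' A.1 = N.E := congrArg Subtype.val hA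
    rw [← hp.ground_eq, ← h1]
    exact Set.image_subset_range _ _)

theorem flatRank_hyperplane : M.flatRank (hp.leftEmb LowLeft.top) + 1 = k := by
  have h1 : (hp.leftEmb LowLeft.top).1 = Set.range j := by
    change j '' (Finset.univ : Finset (Fin h)) = _
    rw [Finset.coe_univ, Set.image_univ]
  rw [flatRank, h1, hp.rkNat_hyperplane]

theorem top_covBy : hp.leftEmb LowLeft.top ⋖ M.topFlat :=
  covBy_topFlat (hp.flatRank_hyperplane.trans hp.rankNat_left.symm)

theorem new_covBy (B : NewSet k h) : hp.rightEmb B.right ⋖ N.topFlat := by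
  refine covBy_topFlat ?_
  rw [hp.rankNat_right, flatRank_rightEmb]
  exact B.2

theorem flatRank_top_left : M.flatRank M.topFlat = k := hp.rankNat_left

theorem flatRank_top_right : N.flatRank N.topFlat = k := hp.rankNat_right

theorem flatRank_small_left (A : SmallSet k h) : M.flatRank (hp.leftEmb A.left) = A.1.card :=
  hp.rkNat_left A.1 A.2

theorem flatRank_small_right (A : SmallSet k h) : N.flatRank (hp.rightEmb A.right) = A.1.card :=
  hp.rkNat_right A.1 A.2.le

theorem kl_top : kl M.flatRank (hp.leftEmb LowLeft.top) M.topFlat = 1 :=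
  kl_of_covBy hp.top_covBy (by rw [hp.flatRank_top_left, hp.flatRank_hyperplane])

theorem kl_new (B : NewSet k h) : kl N.flatRank (hp.rightEmb B.right) N.topFlat = 1 :=
  kl_of_covBy (hp.new_covBy B) (by
    rw [hp.flatRank_top_right, flatRank_rightEmb]
    exact B.2.symm)

/-- In both lattices the values μ(A, F) sum to zero, and they agree at common proper flats. The
change at the top therefore offsets replacing H by its (k - 1)-subsets. -/
theorem moebius_top_sub (A : SmallSet k h) :
    moebius (hp.rightEmb A.right) N.topFlat - moebius (hp.leftEmb A.left) M.topFlat =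
      -relaxMoebius k h A := by
  have h1 := hp.sum_sub_sum (fun F => moebius (hp.leftEmb A.left) F)
    (fun F => moebius (hp.rightEmb A.right) F)
    (fun F hF => hp.moebius_common (hp.small A) (hp.off hF))
  rw [sum_moebius_eq_zero le_topFlat (hp.lt_topFlat_left A).ne,
    sum_moebius_eq_zero le_topFlat (hp.lt_topFlat_right A.right).ne] at h1
  have h2 : ∀ B : SmallSet k h, moebius (hp.rightEmb A.right) (hp.rightEmb B.right) -
      moebius (hp.leftEmb A.left) (hp.leftEmb B.left) = 0 := fun B =>
    sub_eq_zero.2 (hp.moebius_common (hp.small A) (hp.small B))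
  rw [Finset.sum_eq_zero fun B _ => h2 B] at h1
  simp only [moebius_map hp.leftEmb hp.leftEmb_ordConnected,
    moebius_map hp.rightEmb hp.rightEmb_ordConnected] at h1
  rw [relaxMoebius]
  linarith

/-- The replaced flats have corank one and change the coefficient of t; the top changes the constant
term by the opposite amount. -/
theorem charPoly_top_sub (A : SmallSet k h) :
    charPoly N.flatRank (hp.rightEmb A.right) N.topFlat -
      charPoly M.flatRank (hp.leftEmb A.left) M.topFlat =
      (Polynomial.X - 1) * Polynomial.C (relaxMoebius k h A) := by
  rw [charPoly_eq_sum _ _ le_topFlat, charPoly_eq_sum _ _ le_topFlat, hp.sum_sub_sum]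
  · have h2 : ∀ B : SmallSet k h,
        Polynomial.C (moebius (hp.rightEmb A.right) (hp.rightEmb B.right)) *
          Polynomial.X ^ (N.flatRank N.topFlat - N.flatRank (hp.rightEmb B.right)) -
        Polynomial.C (moebius (hp.leftEmb A.left) (hp.leftEmb B.left)) *
          Polynomial.X ^ (M.flatRank M.topFlat - M.flatRank (hp.leftEmb B.left)) = 0 := by
      intro B
      have h3 : moebius (hp.rightEmb A.right) (hp.rightEmb B.right) =
          moebius (hp.leftEmb A.left) (hp.leftEmb B.left) :=
        hp.moebius_common (hp.small A) (hp.small B)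
      rw [h3, flatRank_top_left hp, flatRank_top_right hp, flatRank_small_left,
        flatRank_small_right, sub_self]
    have h4 : ∀ B : NewSet k h, N.flatRank N.topFlat - N.flatRank (hp.rightEmb B.right) = 1 := by
      intro B
      have h5 := B.2
      rw [hp.flatRank_top_right, flatRank_rightEmb]
      change k - B.1.card = 1
      omega
    have h6 : M.flatRank M.topFlat - M.flatRank (hp.leftEmb LowLeft.top) = 1 := by
      have := hp.flatRank_hyperplane
      rw [hp.flatRank_top_left]
      omega
    have h7 := congrArg (Polynomial.C : ℤ → ℤ[X]) (hp.moebius_top_sub A)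
    rw [Finset.sum_eq_zero fun B _ => h2 B]
    simp only [h4, h6, moebius_map hp.leftEmb hp.leftEmb_ordConnected,
      moebius_map hp.rightEmb hp.rightEmb_ordConnected, Nat.sub_self, pow_zero, pow_one, mul_one,
      add_zero, ← Finset.sum_mul]
    rw [map_sub, map_neg] at h7
    rw [h7, relaxMoebius, map_sub, map_sum]
    ring
  · intro F hF
    have h1 : moebius (hp.rightEmb A.right) (hp.offRight F) =
        moebius (hp.leftEmb A.left) (offLeft M j F) :=
      hp.moebius_common (hp.small A) (hp.off hF)
    rw [h1, flatRank_top_left hp, flatRank_top_right hp, rank_offRight]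

/-- At a proper flat F not inside H, both χ on [A, F] and P on [F, E] are unchanged. At a larger
small set only P changes, at E only χ does, and P = 1 at H and at the new hyperplanes. -/
theorem kl_sub_eq (A : SmallSet k h) :
    kl N.flatRank (hp.rightEmb A.right) N.topFlat - kl M.flatRank (hp.leftEmb A.left) M.topFlat =
      relaxKLStep (fun B => kl N.flatRank (hp.rightEmb B.right) N.topFlat -
        kl M.flatRank (hp.leftEmb B.left) M.topFlat) A := by
  classical
  rw [relaxKLStep, kl_top_eq (hp.lt_topFlat_left A), kl_top_eq (hp.lt_topFlat_right A.right),
    hp.rankNat_left, hp.rankNat_right, flatRank_small_left, flatRank_small_right, neg_sub_neg,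
    ← neg_sub, ← lowerHalf_sub, hp.sum_sub_sum]
  · have hs : ∀ B : SmallSet k h,
        ((if hp.rightEmb A.right < hp.rightEmb B.right then
          charPoly N.flatRank (hp.rightEmb A.right) (hp.rightEmb B.right) *
            kl N.flatRank (hp.rightEmb B.right) N.topFlat else 0) -
        if hp.leftEmb A.left < hp.leftEmb B.left then
          charPoly M.flatRank (hp.leftEmb A.left) (hp.leftEmb B.left) *
            kl M.flatRank (hp.leftEmb B.left) M.topFlat else 0) =
        if A < B then charPoly rightRank A.right B.right *
          (kl N.flatRank (hp.rightEmb B.right) N.topFlat -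
            kl M.flatRank (hp.leftEmb B.left) M.topFlat) else 0 := by
      intro B
      have h1 : charPoly N.flatRank (hp.rightEmb A.right) (hp.rightEmb B.right) =
          charPoly M.flatRank (hp.leftEmb A.left) (hp.leftEmb B.left) :=
        hp.charPoly_common (hp.small A) (hp.small B)
      rw [← h1, charPoly_rightEmb]
      have h2 : A.right < B.right ↔ A < B := Iff.rfl
      have h3 : A.left < B.left ↔ A < B := Iff.rfl
      simp only [OrderEmbedding.lt_iff_lt, h2, h3]
      split_ifs <;> ring
    have hn : ∀ B : NewSet k h,
        (if hp.rightEmb A.right < hp.rightEmb B.right then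
          charPoly N.flatRank (hp.rightEmb A.right) (hp.rightEmb B.right) *
            kl N.flatRank (hp.rightEmb B.right) N.topFlat else 0) =
        charPoly rightRank A.right B.right := by
      intro B
      rw [kl_new, charPoly_rightEmb, mul_one]
      simp only [OrderEmbedding.lt_iff_lt, SmallSet.lt_new_iff]
      split_ifs with hAB
      · rfl
      -- The characteristic polynomial of an empty interval is 0, so the indicator can be dropped.
      · rw [charPoly_of_not_le _ hAB]
    rw [if_pos (hp.lt_topFlat_right A.right), if_pos (hp.lt_topFlat_left A),
      if_pos (hp.leftEmb.lt_iff_lt.2 (SmallSet.lt_top hp.le_add_one A)), kl_self, kl_self,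
      mul_one, mul_one, charPoly_top_sub, kl_top, mul_one, charPoly_leftEmb,
      Finset.sum_congr rfl fun B _ => hs B, Finset.sum_congr rfl fun B _ => hn B]
  · intro F hF
    have h1 : charPoly N.flatRank (hp.rightEmb A.right) (hp.offRight F) =
        charPoly M.flatRank (hp.leftEmb A.left) (offLeft M j F) :=
      hp.charPoly_common (hp.small A) (hp.off hF)
    have h2 : kl N.flatRank (hp.offRight F) N.topFlat =
        kl M.flatRank (offLeft M j F) M.topFlat := by
      rw [← hp.offRight_offTop]
      exact hp.kl_off F.2.1.subset_ground
    have h3 : hp.rightEmb A.right < hp.offRight F ↔ hp.leftEmb A.left < offLeft M j F := Iff.rfl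
    simp only [h1, h2, h3]

/-- The change of the `Z`-polynomial under relaxation, in terms of the change of the
Kazhdan–Lusztig polynomials. -/
theorem zPolynomial_sub_eq : N.zPolynomial - M.zPolynomial =
    ∑ A : SmallSet k h, Polynomial.X ^ A.1.card *
      (kl N.flatRank (hp.rightEmb A.right) N.topFlat -
        kl M.flatRank (hp.leftEmb A.left) M.topFlat) +
    ∑ _B : NewSet k h, Polynomial.X ^ (k - 1) - Polynomial.X ^ (k - 1) := by
  rw [zPolynomial_eq, zPolynomial_eq, hp.sum_sub_sum]
  · have hn : ∀ B : NewSet k h, Polynomial.X ^ N.flatRank (hp.rightEmb B.right) *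
        kl N.flatRank (hp.rightEmb B.right) N.topFlat = (Polynomial.X : ℤ[X]) ^ (k - 1) := by
      intro B
      rw [kl_new, mul_one, flatRank_rightEmb]
      have h1 := B.2
      exact congrArg _ (by change B.1.card = _; omega)
    have h2 : M.flatRank (hp.leftEmb LowLeft.top) = k - 1 := by
      have := hp.flatRank_hyperplane
      omega
    simp only [flatRank_top_left hp, flatRank_top_right hp, kl_self, hn, h2, kl_top,
      flatRank_small_left, flatRank_small_right, ← mul_sub, sub_self, mul_one]
    rw [zero_add]
  · intro F hF
    have h2 : kl N.flatRank (hp.offRight F) N.topFlat =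
        kl M.flatRank (offLeft M j F) M.topFlat := by
      rw [← hp.offRight_offTop]
      exact hp.kl_off F.2.1.subset_ground
    rw [h2, rank_offRight]

theorem loops_right (hk : 1 ≤ k) : N.loops = ∅ := by
  have h1 := (hp.isFlat_right ∅).2 (by simpa using hk)
  rw [Finset.coe_empty, Set.image_empty] at h1
  exact h1.closure

theorem loops_left (hk : 2 ≤ k) : M.loops = ∅ := by
  have h1 := (hp.isFlat_left ∅).2 (Or.inl (by rw [Finset.card_empty]; omega))
  rw [Finset.coe_empty, Set.image_empty] at h1
  exact h1.closure

/-- In rank one the hyperplane has rank 0 and consists of loops; it is nonempty since h ≥ 1. -/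
theorem loops_left_of_eq_one (hk : k = 1) (hh : 1 ≤ h) : M.loops ≠ ∅ := by
  intro hl
  have h1 : M.IsFlat (j '' ((∅ : Finset (Fin h)) : Set (Fin h))) := by
    rw [Finset.coe_empty, Set.image_empty, ← hl]
    exact M.isFlat_closure ∅
  rw [hp.isFlat_left, hk] at h1
  rcases h1 with h1 | h1
  · simp at h1
  · have h2 := congrArg Finset.card h1
    rw [Finset.card_empty, Finset.card_univ, Fintype.card_fin] at h2
    omega

theorem minFlat_left (hk : 2 ≤ k) : M.minFlat = hp.leftEmb (SmallSet.empty hk).left := by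
  refine Subtype.ext ?_
  rw [minFlat_val (hp.loops_left hk)]
  exact (by rw [Finset.coe_empty, Set.image_empty] :
    j '' ((∅ : Finset (Fin h)) : Set (Fin h)) = ∅).symm

theorem minFlat_right (hk : 2 ≤ k) : N.minFlat = hp.rightEmb (SmallSet.empty hk).right := by
  refine Subtype.ext ?_
  rw [minFlat_val (hp.loops_right (by omega))]
  exact (by rw [Finset.coe_empty, Set.image_empty] :
    j '' ((∅ : Finset (Fin h)) : Set (Fin h)) = ∅).symm

/-- No recursion for the change is needed here: Q on [∅, B] is unchanged for small B, and only χ on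
[B, E] varies. The terms of H and of its (k - 1)-subsets carry the reflected factor 1 - t. -/
theorem invKLPolynomial_sub_eq (hk : 2 ≤ k) :
    N.invKLPolynomial - M.invKLPolynomial = relaxInvKL h hk := by
  classical
  have hM : M.minFlat < M.topFlat := by
    rw [hp.minFlat_left hk]
    exact hp.lt_topFlat_left _
  have hN : N.minFlat < N.topFlat := by
    rw [hp.minFlat_right hk]
    exact hp.lt_topFlat_right _
  rw [invKLPolynomial_eq (hp.loops_left hk), invKLPolynomial_eq (hp.loops_right (by omega)),
    invKL_top_eq hM.ne, invKL_top_eq hN.ne, hp.rankNat_left, hp.rankNat_right, relaxInvKL,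
    ← mul_sub, ← lowerHalf_sub, hp.sum_sub_sum]
  · have hs : ∀ B : SmallSet k h,
        ((if hp.rightEmb B.right < N.topFlat then (-1) ^ N.flatRank (hp.rightEmb B.right) *
          invKL N.flatRank N.minFlat (hp.rightEmb B.right) *
            (charPoly N.flatRank (hp.rightEmb B.right) N.topFlat).reflect
              (k - N.flatRank (hp.rightEmb B.right)) else 0) -
        if hp.leftEmb B.left < M.topFlat then (-1) ^ M.flatRank (hp.leftEmb B.left) *
          invKL M.flatRank M.minFlat (hp.leftEmb B.left) *
            (charPoly M.flatRank (hp.leftEmb B.left) M.topFlat).reflect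
              (k - M.flatRank (hp.leftEmb B.left)) else 0) =
        (-1) ^ B.1.card * invKL rightRank (SmallSet.empty hk).right B.right *
          ((Polynomial.X - 1) * Polynomial.C (relaxMoebius k h B)).reflect (k - B.1.card) := by
      intro B
      have h1 : invKL N.flatRank (hp.rightEmb (SmallSet.empty hk).right) (hp.rightEmb B.right) =
          invKL M.flatRank (hp.leftEmb (SmallSet.empty hk).left) (hp.leftEmb B.left) :=
        hp.invKL_common (F := hp.small (SmallSet.empty hk)) (G := hp.small B)
          (Set.image_mono (Finset.coe_subset.2 (Finset.empty_subset B.1)))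
      rw [if_pos (hp.lt_topFlat_left B), if_pos (hp.lt_topFlat_right B.right),
        hp.minFlat_left hk, hp.minFlat_right hk, ← h1, flatRank_small_left, flatRank_small_right,
        ← mul_sub, hp.invKL_rightEmb (Finset.empty_subset B.1), ← Polynomial.reflect_sub,
        charPoly_top_sub]
    have hn : ∀ B : NewSet k h, (if hp.rightEmb B.right < N.topFlat then
        (-1) ^ N.flatRank (hp.rightEmb B.right) *
          invKL N.flatRank N.minFlat (hp.rightEmb B.right) *
            (charPoly N.flatRank (hp.rightEmb B.right) N.topFlat).reflect
              (k - N.flatRank (hp.rightEmb B.right)) else 0) =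
        (-1) ^ (k - 1) * invKL rightRank (SmallSet.empty hk).right B.right *
          (1 - Polynomial.X) := by
      intro B
      have h1 : N.flatRank (hp.rightEmb B.right) = k - 1 := by
        rw [flatRank_rightEmb, ← Nat.add_sub_cancel (n := rightRank B.right) (m := 1)]
        exact congrArg (· - 1) B.2
      rw [if_pos (hp.lt_topFlat_right B.right), hp.minFlat_right hk, h1,
        hp.invKL_rightEmb (Finset.empty_subset B.1), show k - (k - 1) = 1 by omega,
        reflect_charPoly_of_covBy (hp.new_covBy B) (by rw [h1, hp.flatRank_top_right]; omega)]
    have ht : (if hp.leftEmb LowLeft.top < M.topFlat then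
        (-1) ^ M.flatRank (hp.leftEmb LowLeft.top) *
          invKL M.flatRank M.minFlat (hp.leftEmb LowLeft.top) *
            (charPoly M.flatRank (hp.leftEmb LowLeft.top) M.topFlat).reflect
              (k - M.flatRank (hp.leftEmb LowLeft.top)) else 0) =
        (-1) ^ (k - 1) * invKL leftRank (SmallSet.empty (h := h) hk).left LowLeft.top *
          (1 - Polynomial.X) := by
      have h2 := hp.flatRank_hyperplane
      have h1 : M.flatRank (hp.leftEmb LowLeft.top) = k - 1 := by omega
      rw [if_pos hp.top_covBy.lt, hp.minFlat_left hk, h1,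
        hp.invKL_leftEmb (Finset.empty_subset _), show k - (k - 1) = 1 by omega,
        reflect_charPoly_of_covBy hp.top_covBy (by rw [h2, hp.flatRank_top_left])]
    rw [if_neg (lt_irrefl _), if_neg (lt_irrefl _), sub_self, zero_add,
      Finset.sum_congr rfl fun B _ => hs B, Finset.sum_congr rfl fun B _ => hn B, ht]
  · intro F hF
    have h1 : invKL N.flatRank N.minFlat (hp.offRight F) =
        invKL M.flatRank M.minFlat (offLeft M j F) := by
      rw [hp.minFlat_left hk, hp.minFlat_right hk]
      refine hp.invKL_common (F := hp.small (SmallSet.empty hk)) (G := hp.off hF) ?_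
      have h0 : j '' ((∅ : Finset (Fin h)) : Set (Fin h)) ⊆ F.1 := by
        rw [Finset.coe_empty, Set.image_empty]
        exact Set.empty_subset _
      exact h0
    have h2 : charPoly N.flatRank (hp.offRight F) N.topFlat =
        charPoly M.flatRank (offLeft M j F) M.topFlat := by
      rw [← hp.offRight_offTop]
      exact hp.charPoly_off F hp.offTop
    have h3 : hp.offRight F < N.topFlat ↔ offLeft M j F < M.topFlat := by
      rw [← hp.offRight_offTop]
      exact Iff.rfl
    simp only [h1, h2, h3, rank_offRight]

theorem klPolynomial_sub_eq (hk : 2 ≤ k) : N.klPolynomial - M.klPolynomial =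
    kl N.flatRank (hp.rightEmb (SmallSet.empty hk).right) N.topFlat -
      kl M.flatRank (hp.leftEmb (SmallSet.empty hk).left) M.topFlat := by
  rw [klPolynomial_eq (hp.loops_left hk), klPolynomial_eq (hp.loops_right (by omega)),
    hp.minFlat_left hk, hp.minFlat_right hk]

theorem minFlat_covBy_of_eq_one (hk : k = 1) : N.minFlat ⋖ N.topFlat :=
  covBy_topFlat (by rw [flatRank_minFlat, hp.rankNat_right, hk])

theorem klPolynomial_sub_of_eq_one (hk : k = 1) (hh : 1 ≤ h) :
    N.klPolynomial - M.klPolynomial = 1 := by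
  rw [klPolynomial_of_loops (hp.loops_left_of_eq_one hk hh),
    klPolynomial_eq (hp.loops_right hk.ge), sub_zero]
  exact kl_of_covBy (hp.minFlat_covBy_of_eq_one hk)
    (by rw [flatRank_minFlat, hp.flatRank_top_right, hk])

theorem invKLPolynomial_sub_of_eq_one (hk : k = 1) (hh : 1 ≤ h) :
    N.invKLPolynomial - M.invKLPolynomial = 1 := by
  rw [invKLPolynomial_of_loops (hp.loops_left_of_eq_one hk hh),
    invKLPolynomial_eq (hp.loops_right hk.ge), sub_zero]
  exact invKL_of_covBy (hp.minFlat_covBy_of_eq_one hk)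
    (by rw [flatRank_minFlat, hp.flatRank_top_right, hk])

/-! The changes are the same for two relaxations with the same parameters. -/

section Compare

variable {β : Type v} {M' N' : Matroid β} {j' : Fin h ↪ β}
  (hp' : IsRelaxationPair M' N' k h j') [M'.Finite] [N'.Finite]

include hp'

/-- Both differences satisfy the same recursion, which refers only to k and h. -/
theorem kl_sub_congr (A : SmallSet k h) :
    kl N.flatRank (hp.rightEmb A.right) N.topFlat - kl M.flatRank (hp.leftEmb A.left) M.topFlat =
      kl N'.flatRank (hp'.rightEmb A.right) N'.topFlat -
        kl M'.flatRank (hp'.leftEmb A.left) M'.topFlat :=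
  eq_of_relaxKLStep hp.kl_sub_eq hp'.kl_sub_eq A

theorem klPolynomial_sub_congr (hk : 1 ≤ k) (hh : 1 ≤ h) :
    N.klPolynomial - M.klPolynomial = N'.klPolynomial - M'.klPolynomial := by
  rcases hk.eq_or_lt with hk | hk
  · rw [hp.klPolynomial_sub_of_eq_one hk.symm hh, hp'.klPolynomial_sub_of_eq_one hk.symm hh]
  · rw [hp.klPolynomial_sub_eq hk, hp'.klPolynomial_sub_eq hk, hp.kl_sub_congr hp']

theorem invKLPolynomial_sub_congr (hk : 1 ≤ k) (hh : 1 ≤ h) :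
    N.invKLPolynomial - M.invKLPolynomial = N'.invKLPolynomial - M'.invKLPolynomial := by
  rcases hk.eq_or_lt with hk | hk
  · rw [hp.invKLPolynomial_sub_of_eq_one hk.symm hh, hp'.invKLPolynomial_sub_of_eq_one hk.symm hh]
  · rw [hp.invKLPolynomial_sub_eq hk, hp'.invKLPolynomial_sub_eq hk]

/-- Rank one needs no special treatment, since Z is insensitive to loops. -/
theorem zPolynomial_sub_congr :
    N.zPolynomial - M.zPolynomial = N'.zPolynomial - M'.zPolynomial := by
  rw [hp.zPolynomial_sub_eq, hp'.zPolynomial_sub_eq]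
  simp only [hp.kl_sub_congr hp']

end Compare

end IsRelaxationPair

theorem IsStressedHyperplane.exists_isRelaxationPair {α : Type u} {M : Matroid α} [M.Finite]
    {H : Set α} (hH : M.IsStressedHyperplane H) {h : ℕ} (hh : H.ncard = h) :
    ∃ j : Fin h ↪ α, IsRelaxationPair M (M.relaxation hH) M.rankNat h j := by
  have hfin : H.Finite := M.ground_finite.subset hH.subset_ground
  have := hfin.to_subtype
  let e : Fin h ≃ H := (Finite.equivFinOfCardEq (by rw [← hh]; rfl)).symm
  have hr : Set.range (e.toEmbedding.trans (Function.Embedding.subtype _)) = H := by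
    ext x
    simp only [Set.mem_range, Function.Embedding.trans_apply, Function.Embedding.subtype_apply,
      Equiv.coe_toEmbedding]
    exact ⟨fun ⟨y, hy⟩ => hy ▸ (e y).2, fun hx => ⟨e.symm ⟨x, hx⟩, by simp⟩⟩
  -- The enumeration is made opaque so that H can be replaced by its range.
  generalize e.toEmbedding.trans (Function.Embedding.subtype _) = j at hr
  subst hr
  exact ⟨j, hH.isRelaxationPair⟩

/-- If the change of `Φ` under relaxation depends only on the rank and the size of the stressed
hyperplane, then it can be computed from one example. -/
theorem isRelaxationCorrection_iff {Φ : ∀ (α : Type u) (M : Matroid α) [M.Finite], ℤ[X]}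
    {k h : ℕ} {β : Type u} (W : Matroid β) [W.Finite] {G : Set β} (hG : W.IsStressedHyperplane G)
    (hWk : W.rankNat = k) (hGh : G.ncard = h)
    (hΦ : ∀ (α : Type u) (M : Matroid α) [M.Finite] (H : Set α) (hH : M.IsStressedHyperplane H),
      M.rankNat = k → H.ncard = h →
        Φ α (M.relaxation hH) - Φ α M = Φ β (W.relaxation hG) - Φ β W) (p : ℤ[X]) :
    IsRelaxationCorrection Φ k h p ↔ p = Φ β (W.relaxation hG) - Φ β W := by
  constructor
  · intro hp
    rw [hp β W G hG hWk hGh, add_sub_cancel_left]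
  · rintro rfl α M _ H hH hk hh
    rw [← hΦ α M H hH hk hh, add_sub_cancel]

end Matroid

/-! ### Evaluation of the corrections on the coloop extension of a uniform matroid -/

open Matroid in
theorem mainTheorem3 (k h : ℕ) (hk : 1 ≤ k) (hh : 1 ≤ h) (hkh : k ≤ h + 1) :
    (∀ p : ℤ[X],
      Matroid.IsRelaxationCorrection.{u} (fun _ M _ => M.klPolynomial) k h p ↔
        p = (Matroid.uniform k (h + 1)).klPolynomial -
          (Matroid.uniform (k - 1) h).klPolynomial) ∧
    (∀ q : ℤ[X],
      Matroid.IsRelaxationCorrection.{u} (fun _ M _ => M.invKLPolynomial) k h q ↔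
        q = (Matroid.uniform k (h + 1)).invKLPolynomial -
          (Matroid.uniform (k - 1) h).invKLPolynomial) ∧
    (∀ z : ℤ[X],
      Matroid.IsRelaxationCorrection.{u} (fun _ M _ => M.zPolynomial) k h z ↔
        z = (Matroid.uniform k (h + 1)).zPolynomial -
          (1 + Polynomial.X) * (Matroid.uniform (k - 1) h).zPolynomial) := by
  obtain ⟨r, rfl⟩ : ∃ r, k = r + 1 := ⟨k - 1, by omega⟩
  have hr : r ≤ h := by omega
  rw [Nat.add_sub_cancel]
  -- The coloop is taken in universe u, which places the example among the matroids quantified over.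
  have hS := isStressedHyperplane_addColoop_uniform.{u} hr
  have hWk := rankNat_addColoop_uniform.{u} hr
  have hGh : (Set.range (Sum.inl : Fin h → Fin h ⊕ PUnit.{u + 1})).ncard = h := by
    rw [← Set.image_univ, Set.ncard_image_of_injective _ Sum.inl_injective, Set.ncard_univ,
      Nat.card_eq_fintype_card, Fintype.card_fin]
  obtain ⟨j', hW⟩ := hS.exists_isRelaxationPair hGh
  rw [hWk] at hW
  -- Any bijection serves, because a uniform matroid is determined by the cardinalities of its
  -- bases.
  have f : Fin h ⊕ PUnit.{u + 1} ≃ Fin (h + 1) := Fintype.equivFinOfCardEq (by simp)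
  have hU := relaxation_addColoop_uniform.{u} hr f
  have hKL : (uniform (r + 1) (h + 1)).klPolynomial =
      ((addColoop.{0, u} (uniform r h)).relaxation hS).klPolynomial := by
    rw [← klPolynomial_mapEquiv _ f]
    congr 1
    exact hU.symm
  have hIKL : (uniform (r + 1) (h + 1)).invKLPolynomial =
      ((addColoop.{0, u} (uniform r h)).relaxation hS).invKLPolynomial := by
    rw [← invKLPolynomial_mapEquiv _ f]
    congr 1
    exact hU.symm
  have hZ : (uniform (r + 1) (h + 1)).zPolynomial =
      ((addColoop.{0, u} (uniform r h)).relaxation hS).zPolynomial := by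
    rw [← zPolynomial_mapEquiv _ f]
    congr 1
    exact hU.symm
  refine ⟨fun p => ?_, fun q => ?_, fun z => ?_⟩
  -- Both terms are now invariants of the example after and before relaxation.
  · rw [hKL, ← klPolynomial_addColoop.{0, u} (uniform r h)]
    refine isRelaxationCorrection_iff _ hS hWk hGh (fun α M _ H hH hMk hHh => ?_) p
    obtain ⟨j, hp⟩ := hH.exists_isRelaxationPair hHh
    rw [hMk] at hp
    exact hp.klPolynomial_sub_congr hW hk hh
  · rw [hIKL, ← invKLPolynomial_addColoop.{0, u} (uniform r h)]
    refine isRelaxationCorrection_iff _ hS hWk hGh (fun α M _ H hH hMk hHh => ?_) q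
    obtain ⟨j, hp⟩ := hH.exists_isRelaxationPair hHh
    rw [hMk] at hp
    exact hp.invKLPolynomial_sub_congr hW hk hh
  -- Here the factor 1 + t is absorbed by the coloop.
  · rw [hZ, ← zPolynomial_addColoop.{0, u} (uniform r h)]
    refine isRelaxationCorrection_iff _ hS hWk hGh (fun α M _ H hH hMk hHh => ?_) z
    obtain ⟨j, hp⟩ := hH.exists_isRelaxationPair hHh
    rw [hMk] at hp
    exact hp.zPolynomial_sub_congr hW
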